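/- Let $K$ be a field of characteristic $0$, $\lambda$ a partition of $n$ with conjugate $\lambda'$, and $e_r(S)$ the $r$-th elementary symmetric polynomial in a set $S\subseteq\{x_1,\dots,x_n\}$ of variables; $e_r(k)$ denotes $\{e_r(S): |S|=k\}$. The De Concini–Procesi ideal $\mathcal I_\lambda\subseteq K[x_1,\dots,x_n]$ is generated by all $e_r(k)$ with $1\le k\le n$ and $k\ge r>k-\delta_k(\lambda)$, where $\delta_k(\lambda)=\lambda'_n+\lambda'_{n-1}+\dots+\lambda'_{n-k+1}$. Columns of the diagram of $\lambda$ are numbered from $0$, so column $j$ has height $\lambda'_{j+1}$. Put $b_k=\lambda'_1+\dots+\lambda'_k-k+1$. The *reduced generating set* of $\mathcal I_\lambda$ consists of $e_1(n),\dots,e_{b_1-1}(n)$ (column $0$), and of $e_{b_k}(n-k)$ for each column $k\ge1$ that has height $\ge2$ or is the last column of $\lambda$ (with, in addition, $e_n(n)$ if $\lambda=(1^n)$, and $e_1(1)$ if $n=1$). The *Weyman diagram* of $\lambda$ has an $X$ in column $i$ and row $p$ (rows numbered downwards) if and only if $n-i-\delta_{n-i}(\lambda)<p\le n-i$; for $0\le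 i<\lambda_1$ the top $X$ of column $i$ is at $(i,b_i)$. Let $U_{i,p}$ be the image in the polynomial functions on $n\times n$ matrices of the irreducible $GL_n$-component of highest weight $(1^i,0^{n-2i},(-1)^i)$ of $\bigwedge^pE\otimes\bigwedge^pE^*$, $E=K^n$ (the span of the $p\times p$ minors), with $U_{i,p}=0$ if there is no such component, and let $\tilde U_{i,p}\subseteq K[x_1,\dots,x_n]$ be its restriction to diagonal matrices. The generating set $\tilde{\mathcal W}_\lambda$ of the diagonal version of Weyman's conjecture is the union of bases of $\tilde U_{0,p}$, $1\le p\le\ell(\lambda)$, and of $\tilde U_{i,p}$ for those top cells $(i,p)$, $i\ge1$, of the Weyman diagram for which no $X$ other than the end points lies on the segment joining $(0,1)$ with $(i,p)$, or to the right of it in a row $q$ with $1\le q<p$; the conjecture says that $\tilde{\mathcal W}_\lambda$ is a minimal generating set of $\mathcal I_\lambda$. Consider the two families of partitions 1. $(u^a,(u-1)^c,1)$ with $u\ge3$, $g=a+c>1$; put $m=2$; 2. $(u^a,(u-1)^c,1,1)$ with $u\ge4$, $g=a+c+1>2$; put $m=3$. Let $m<l<\lambda_1$ and suppose that the columns $0,\dots,l$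 of $\lambda$ form the diagram of a partition of the first family ($m=2$) or of the second family ($m=3$). (In particular $\lambda$ can be any member of the first family with more than $3$ columns, or of the second family with more than $4$ columns, with $l=\lambda_1-1$.) Then: (a) For $1\le i\le l$ we have $b_i=i(g+1-m)+m$, so that the top cells $(i,b_i)$ lie on a line that passes through $(0,m)$; each of these cells satisfies the condition in the definition of $\tilde{\mathcal W}_\lambda$, and $\tilde U_{i,b_i}\ne0$, so generators from each of these cells belong to $\tilde{\mathcal W}_\lambda$. (b) The reduced generating set generates $\mathcal I_\lambda$, and still does so when the generators from all columns $k$ with $m<k\le l$ are deleted; for these $k$, all elements of $e_{b_k}(n-k)$ lie in the ideal generated by the reduced generators from columns $0,\dots,m$. (c) For every choice of the bases, $\tilde{\mathcal W}_\lambda$ generates $\mathcal I_\lambda$, and still does so when the generators from all cells $(k,b_k)$ with $m<k\le l$ are deleted; for these $k$, the chosen basis of $\tilde U_{k,b_k}$ lies in the ideal generated by the elements of $\tilde{\mathcal W}_\lambda$ from columns $0,\dots,m$. Hence $\tilde{\mathcal W}_\lambda$ is not a minimal generating set of $\mathcal I_\lambda$: $\lambda$ is a counterexample to the diagonal version of Weyman's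 conjecture. -/

import Mathlib

open MvPolynomial

noncomputable section

namespace DeConciniProcesi

/-! ### Diagrams

A partition `μ` of `n = μ.card` is a `YoungDiagram`. Rows and columns are numbered from `0`:
`μ.rowLen 0` is the largest part (the number of columns), `μ.colLen 0` the number of parts,
`μ.colLen j` the height of column `j` (the `(j+1)`-st part of the conjugate partition). -/

/-- The diagram formed by the first `m` columns (columns `0, …, m - 1`) of `μ`. -/
def firstColumns (μ : YoungDiagram) (m : ℕ) : YoungDiagram where
  cells := μ.cells.filter fun c => c.2 < m
  isLowerSet := by
    intro a b hba ha
    simp only [Finset.coe_filter, Set.mem_ofPred_eq] at ha ⊢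
    exact ⟨μ.isLowerSet hba ha.1, lt_of_le_of_lt hba.2 ha.2⟩

theorem firstColumns_rowLen_zero (μ : YoungDiagram) : firstColumns μ (μ.rowLen 0) = μ := by
  ext ⟨i, j⟩
  simp only [firstColumns, Finset.mem_filter, YoungDiagram.mem_cells, and_iff_left_iff_imp]
  intro h
  exact YoungDiagram.mem_iff_lt_rowLen.1 (μ.up_left_mem (Nat.zero_le i) le_rfl h)

/-- `μ = (u^a, (u-1)^c, 1)` with `u ≥ 3` and `g = a + c > 1`. -/
def IsFamilyOne (g : ℕ) (μ : YoungDiagram) : Prop :=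
  ∃ u a c : ℕ, 3 ≤ u ∧ g = a + c ∧ 1 < g ∧
    μ.rowLens = List.replicate a u ++ List.replicate c (u - 1) ++ [1]

/-- `μ = (u^a, (u-1)^c, 1, 1)` with `u ≥ 4` and `g = a + c + 1 > 2`. -/
def IsFamilyTwo (g : ℕ) (μ : YoungDiagram) : Prop :=
  ∃ u a c : ℕ, 4 ≤ u ∧ g = a + c + 1 ∧ 2 < g ∧
    μ.rowLens = List.replicate a u ++ List.replicate c (u - 1) ++ [1, 1]

/-- `δ_k(μ) = μ'_n + μ'_{n-1} + ⋯ + μ'_{n-k+1}`, for `k ≤ n = μ.card`. -/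
def delta (μ : YoungDiagram) (k : ℕ) : ℕ :=
  ∑ j ∈ Finset.Ico (μ.card - k) μ.card, μ.colLen j

/-- `b_k = μ'_1 + ⋯ + μ'_k - k + 1`. For a column `k` of height at least `2`, and for the last
column if it has height `1`, this is the entry of its top cell in the regular filling. -/
def topEntry (μ : YoungDiagram) (k : ℕ) : ℕ :=
  (∑ j ∈ Finset.range k, μ.colLen j) + 1 - k

/-! ### The De Concini-Procesi ideal and its reduced generating set -/

section Ideal

variable (K : Type*) [Field K]

/-- The partially symmetric polynomial `e_r(S)`, for a set `S` of variables. -/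
def partialEsymm {n : ℕ} (S : Finset (Fin n)) (r : ℕ) : MvPolynomial (Fin n) K :=
  ∑ T ∈ S.powersetCard r, ∏ i ∈ T, X i

/-- The set `e_r(m)` of all `e_r(S)` with `|S| = m`. -/
def esymmSet (n r m : ℕ) : Set (MvPolynomial (Fin n) K) :=
  {f | ∃ S : Finset (Fin n), S.card = m ∧ f = partialEsymm K S r}

/-- The De Concini-Procesi ideal of `μ`, by Tanisaki's generators: all of `e_r(k)` for
`1 ≤ k ≤ n` and `k ≥ r > k - δ_k(μ)`. -/
def dpIdeal (μ : YoungDiagram) : Ideal (MvPolynomial (Fin μ.card) K) :=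
  Ideal.span {f | ∃ k r : ℕ, 1 ≤ k ∧ k ≤ μ.card ∧ r ≤ k ∧ k < r + delta μ k ∧
    f ∈ esymmSet K μ.card r k}

/-- The generators read from column `j` of the regular filling, in the reduced generating set of
`dpIdeal K μ`: `e_1(n), …, e_{b_1 - 1}(n)` for column `0`; only the top entry, `e_{b_j}(n - j)`, for
a column `j ≥ 1` of height at least `2` and for the last column. The element `e_n(n)` is added
if `μ` has only one column. -/
def columnGens (μ : YoungDiagram) (j : ℕ) : Set (MvPolynomial (Fin μ.card) K) :=
  {f | j = 0 ∧ ∃ r : ℕ, 1 ≤ r ∧ r < topEntry μ 1 ∧ f ∈ esymmSet K μ.card r μ.card} ∪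
  {f | j = 0 ∧ μ.rowLen 0 = 1 ∧ f ∈ esymmSet K μ.card μ.card μ.card} ∪
  {f | (1 ≤ j ∧ 2 ≤ μ.colLen j ∨ j + 1 = μ.rowLen 0 ∧ (1 ≤ j ∨ μ.card = 1)) ∧
    f ∈ esymmSet K μ.card (topEntry μ j) (μ.card - j)}

end Ideal

/-! ### Weyman's generators -/

section Weyman

variable (K : Type*) [Field K]

/-- `c` is (the coefficient tensor of) an element of `⋀^i E ⊗ ⋀^i E*`, `E = K^n`, killed by the
contraction to `⋀^(i-1) E ⊗ ⋀^(i-1) E*`. In characteristic `0` these tensors form the irreducible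
representation of `GL(n)` of highest weight `(1^i, 0^(n-2i), (-1)^i)` if `2 i ≤ n`, and `0`
otherwise. -/
structure IsTracelessAlternating {n i : ℕ} (c : (Fin i → Fin n) → (Fin i → Fin n) → K) :
    Prop where
  alt_left : ∀ (σ : Equiv.Perm (Fin i)) (a b : Fin i → Fin n),
    c (a ∘ σ) b = (Equiv.Perm.sign σ : ℤ) • c a b
  alt_right : ∀ (σ : Equiv.Perm (Fin i)) (a b : Fin i → Fin n),
    c a (b ∘ σ) = (Equiv.Perm.sign σ : ℤ) • c a b
  trace_zero : ∀ (s : Fin i) (a b : Fin i → Fin n),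
    ∑ m : Fin n, c (Function.update a s m) (Function.update b s m) = 0

/-- The sum over all `d` of the minors of the generic `n × n` matrix with rows `a, d` and columns
`b, d`: the image of `e_a ⊗ e_b*` under
`⋀^i E ⊗ ⋀^i E* → ⋀^(i+q) E ⊗ ⋀^(i+q) E* → K[x_(r,s)]`, up to the factor `q!`. -/
def minorSum {n i : ℕ} (q : ℕ) (a b : Fin i → Fin n) : MvPolynomial (Fin n × Fin n) K :=
  ∑ d : Fin q → Fin n,
    ((Matrix.mvPolynomialX (Fin n) (Fin n) K).submatrix (Sum.elim a d) (Sum.elim b d)).det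

/-- Weyman's space of polynomials `U_{i,p}` on `n × n` matrices: the image of the irreducible
component of highest weight `(1^i, 0^(n-2i), (-1)^i)` of `⋀^p E ⊗ ⋀^p E*` (the span of the
`p × p` minors). It is `0` if `i > p`. -/
def weymanU (n i p : ℕ) : Submodule K (MvPolynomial (Fin n × Fin n) K) :=
  Submodule.span K {f | ∃ (q : ℕ) (c : (Fin i → Fin n) → (Fin i → Fin n) → K),
    i + q = p ∧ IsTracelessAlternating K c ∧
    f = ∑ a : Fin i → Fin n, ∑ b : Fin i → Fin n, C (c a b) * minorSum K q a b}

/-- Restriction of polynomial functions on `n × n` matrices to the diagonal matrices. -/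
def restrictDiag (n : ℕ) : MvPolynomial (Fin n × Fin n) K →ₐ[K] MvPolynomial (Fin n) K :=
  aeval fun ij => if ij.1 = ij.2 then X ij.1 else 0

/-- The diagonal version of `U_{i,p}`. -/
def diagU (n i p : ℕ) : Submodule K (MvPolynomial (Fin n) K) :=
  (weymanU K n i p).map (restrictDiag K n).toLinearMap

/-- `B` is a basis (as a set of vectors) of the space `V`. -/
def IsBasisSet {M : Type*} [AddCommGroup M] [Module K M] (B : Set M) (V : Submodule K M) : Prop :=
  LinearIndepOn K id B ∧ Submodule.span K B = V

end Weyman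

/-- There is an `X` in column `i` and row `p` of the Weyman diagram of `μ`: column `i` consists of
the entries `p` of column `i` of the antidiagonal filling, that is
`n - i - δ_{n-i}(μ) < p ≤ n - i`. -/
def IsWeymanCell (μ : YoungDiagram) (i p : ℕ) : Prop :=
  i + p ≤ μ.card ∧ μ.card - i < p + delta μ (μ.card - i)

/-- `(i, p)` is the top `X` of column `i` of the Weyman diagram (row numbers grow downwards). -/
def IsTopWeymanCell (μ : YoungDiagram) (i p : ℕ) : Prop :=
  IsWeymanCell μ i p ∧ ∀ q, IsWeymanCell μ i q → p ≤ q

/-- `(j, q)` lies on the line segment joining `(0, 1)` with `(i, p)`, or to the right of it, in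
one of the rows `1 ≤ q < p` (here `i ≥ 1`; in row `q` of a non-horizontal segment the abscissa is
`i (q - 1) / (p - 1)`). Points of row `p` beyond the end point `(i, p)` do not count. -/
def OnOrRightOfSegment (i p j q : ℕ) : Prop :=
  (j ≤ i ∧ ((q : ℤ) - 1) * i = j * ((p : ℤ) - 1)) ∨
  (1 ≤ q ∧ q < p ∧ ((q : ℤ) - 1) * i < j * ((p : ℤ) - 1))

/-- The index set of the generators in Weyman's conjecture: `(0, p)` for `1 ≤ p ≤ ℓ(μ)`, and the
top cells `(i, p)`, `i ≥ 1`, such that no `X`, other than the end points, lies on or to the right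
of the segment joining `(0, 1)` with `(i, p)`. -/
def weymanLabels (μ : YoungDiagram) : Set (ℕ × ℕ) :=
  {ip | ip.1 = 0 ∧ 1 ≤ ip.2 ∧ ip.2 ≤ μ.colLen 0} ∪
  {ip | 1 ≤ ip.1 ∧ IsTopWeymanCell μ ip.1 ip.2 ∧
    ∀ j q : ℕ, IsWeymanCell μ j q → (j, q) ≠ (0, 1) → (j, q) ≠ ip →
      ¬ OnOrRightOfSegment ip.1 ip.2 j q}

/-- The union of the sets `B (i, p)` over the labels `(i, p)` in `L`. If `B (i, p)` is a basis of
`diagU K n i p` for all `(i, p)` and `L = weymanLabels μ`, this is the generating set predicted by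
the diagonal version of Weyman's conjecture. -/
def genSet {R : Type*} (L : Set (ℕ × ℕ)) (B : ℕ × ℕ → Set R) : Set R :=
  ⋃ ip ∈ L, B ip

/-- `W` generates the ideal `I` and no proper subset of `W` does. -/
def IsMinimalGeneratingSet {R : Type*} [CommRing R] (I : Ideal R) (W : Set R) : Prop :=
  Ideal.span W = I ∧ ∀ W' : Set R, W' ⊂ W → Ideal.span W' ≠ I

end DeConciniProcesi

end

noncomputable section

namespace DeConciniProcesi

/-! ### Column heights, top cells and the Weyman diagram. -/

section Diagrams

/-! Put s = g + 1 - m. Column 0 has height s + m and columns 1, …, l - 1 have height s + 1, whence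
b_i = i s + m for 1 ≤ i ≤ l.

Redundancy. Work modulo an ideal J that contains all e_r(n) with r ≥ 1, and put y = -x. Then ∏ (1 -
y t) = 1, so e_r of the complement of S is the coefficient of t^r in the product over S of 1/(1 - y
t). Column 1 says that y^(s+m) = 0, so each factor is a geometric series truncated after degree s +
m - 1. Split it into the part of degree at most s and a tail in degrees s + 1, …, s + m - 1, and
expand: the coefficient of t^(ks+m), k = |S|, can only come from sets T ⊆ S whose product of tails
has degree at least |T| s + m. For m = 2 and m = 3 the relations of columns 1, …, m rule this out
(`coeff_prod_truncGeom_two`, `coeff_prod_truncGeom_three`), so the relation of every column k on the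
line follows (`esymmSet_line_subset`).

Weyman's generators. On diagonal matrices, tracelessness turns each element of U_{i,p} into a
combination of the e_p(n - i) (`IsTracelessAlternating.restrictDiag_eq_mixedSum`). Conversely,
functions on i-subsets split into the kernel of the down operator and the image of the up operator,
so e_p(n - i) lies in the span of e_p(n - i + 1) plus `diagU` (`esymmSet_subset_span_sup_diagU`).
Column by column, Weyman's generators can thus replace the e_{b_i}(n - i), and the redundancy
carries over.

The deleted generators really are predicted: the slopes from (0, 1) to the top cells decrease
strictly (`mem_weymanLabels_of_lt`), and an alternating evaluation shows `diagU` to be nonzero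
(`diagU_ne_bot`). A basis element from column l has degree b_l > b_m, so it is not itself one of the
generators from columns 0, …, m whose ideal contains it; dropping it contradicts minimality. -/

theorem colLen_pos_iff {μ : YoungDiagram} {j : ℕ} : 0 < μ.colLen j ↔ j < μ.rowLen 0 := by
  rw [← YoungDiagram.mem_iff_lt_colLen, YoungDiagram.mem_iff_lt_rowLen]

theorem sum_colLen_eq_card (μ : YoungDiagram) {N : ℕ} (h : μ.rowLen 0 ≤ N) :
    ∑ j ∈ Finset.range N, μ.colLen j = μ.card := by
  have := Finset.card_eq_sum_card_fiberwise (f := Prod.snd) (s := μ.cells) (t := Finset.range N) (by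
    rintro ⟨i, j⟩ hc
    simp only [Finset.coe_range, Set.mem_Iio]
    exact lt_of_lt_of_le (YoungDiagram.mem_iff_lt_rowLen.1
      (μ.up_left_mem (Nat.zero_le i) le_rfl hc)) h)
  rw [YoungDiagram.card, this]
  exact Finset.sum_congr rfl fun j _ => μ.colLen_eq_card

theorem rowLen_zero_le_card (μ : YoungDiagram) : μ.rowLen 0 ≤ μ.card := by
  rw [YoungDiagram.rowLen_eq_card]
  exact Finset.card_le_card (Finset.filter_subset _ _)

theorem le_sum_colLen {μ : YoungDiagram} {i : ℕ} (hi : i ≤ μ.rowLen 0) :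
    i ≤ ∑ j ∈ Finset.range i, μ.colLen j := by
  have := Finset.card_nsmul_le_sum (Finset.range i) μ.colLen 1 fun j hj =>
    colLen_pos_iff.2 (lt_of_lt_of_le (Finset.mem_range.1 hj) hi)
  simpa using this

/-- The first i columns are nonempty, so the subtraction in `topEntry` is not truncated. -/
theorem topEntry_add {μ : YoungDiagram} {i : ℕ} (hi : i ≤ μ.rowLen 0) :
    topEntry μ i + i = (∑ j ∈ Finset.range i, μ.colLen j) + 1 := by
  have := le_sum_colLen hi
  rw [topEntry]
  omega

theorem topEntry_pos {μ : YoungDiagram} {i : ℕ} (hi : i ≤ μ.rowLen 0) : 1 ≤ topEntry μ i := by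
  have := le_sum_colLen hi
  rw [topEntry]
  omega

theorem topEntry_zero (μ : YoungDiagram) : topEntry μ 0 = 1 := by
  simp [topEntry]

theorem topEntry_one (μ : YoungDiagram) : topEntry μ 1 = μ.colLen 0 := by
  simp [topEntry]

theorem topEntry_succ {μ : YoungDiagram} {i : ℕ} (hi : i < μ.rowLen 0) :
    topEntry μ (i + 1) + 1 = topEntry μ i + μ.colLen i := by
  have h1 := topEntry_add hi.le
  have h2 := topEntry_add (Nat.succ_le_of_lt hi)
  rw [Nat.succ_eq_add_one, Finset.sum_range_succ] at h2
  omega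

theorem topEntry_mono {μ : YoungDiagram} {i j : ℕ} (hij : i ≤ j) (hj : j ≤ μ.rowLen 0) :
    topEntry μ i ≤ topEntry μ j := by
  induction j, hij using Nat.le_induction with
  | base => exact le_rfl
  | succ j hij ih =>
    have := topEntry_succ (Nat.lt_of_succ_le hj)
    have := colLen_pos_iff.2 (Nat.lt_of_succ_le hj)
    have := ih (by omega)
    omega

theorem topEntry_add_le_card {μ : YoungDiagram} {i : ℕ} (hi : i < μ.rowLen 0) :
    i + topEntry μ i ≤ μ.card := by
  have h1 := topEntry_add hi.le
  have h2 := colLen_pos_iff.2 hi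
  have h3 : ∑ j ∈ Finset.range (i + 1), μ.colLen j ≤ ∑ j ∈ Finset.range (μ.rowLen 0), μ.colLen j :=
    Finset.sum_le_sum_of_subset (Finset.range_mono hi)
  rw [sum_colLen_eq_card μ le_rfl, Finset.sum_range_succ] at h3
  omega

theorem sum_colLen_add_delta {μ : YoungDiagram} {i : ℕ} (hi : i ≤ μ.card) :
    (∑ j ∈ Finset.range i, μ.colLen j) + delta μ (μ.card - i) = μ.card := by
  rw [delta, Nat.sub_sub_self hi, Finset.sum_range_add_sum_Ico _ hi]
  exact sum_colLen_eq_card μ (rowLen_zero_le_card μ)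

/-- `delta μ (n - i)` is n minus the sum of the first i heights, which turns the lower bound on p
into b_i ≤ p. Beyond the last column it is 0 and no p is left. -/
theorem isWeymanCell_iff {μ : YoungDiagram} {i p : ℕ} :
    IsWeymanCell μ i p ↔ i < μ.rowLen 0 ∧ topEntry μ i ≤ p ∧ i + p ≤ μ.card := by
  rw [IsWeymanCell]
  constructor
  · rintro ⟨h1, h2⟩
    have h3 := sum_colLen_add_delta (μ := μ) (i := i) (by omega)
    have hi : i < μ.rowLen 0 := by
      by_contra hi
      rw [sum_colLen_eq_card μ (not_lt.1 hi)] at h3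
      omega
    have := topEntry_add hi.le
    exact ⟨hi, by omega, h1⟩
  · rintro ⟨hi, h1, h2⟩
    have h3 := sum_colLen_add_delta (μ := μ) (i := i) (by omega)
    have := topEntry_add hi.le
    exact ⟨h2, by omega⟩

theorem isTopWeymanCell_iff {μ : YoungDiagram} {i p : ℕ} :
    IsTopWeymanCell μ i p ↔ i < μ.rowLen 0 ∧ p = topEntry μ i := by
  constructor
  · rintro ⟨h1, h2⟩
    obtain ⟨hi, hp, _⟩ := isWeymanCell_iff.1 h1
    exact ⟨hi, le_antisymm
      (h2 _ (isWeymanCell_iff.2 ⟨hi, le_rfl, topEntry_add_le_card hi⟩)) hp⟩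
  · rintro ⟨hi, rfl⟩
    exact ⟨isWeymanCell_iff.2 ⟨hi, le_rfl, topEntry_add_le_card hi⟩,
      fun q hq => (isWeymanCell_iff.1 hq).2.1⟩

/-- The right side is the sum of (height - 1) over the columns before j. Each summand is at least
the height of column j minus 1, and the one of column 0 is larger. -/
theorem mul_colLen_sub_one_lt {μ : YoungDiagram} (h : μ.colLen 1 < μ.colLen 0) {j : ℕ}
    (hj : 1 ≤ j) (hj' : j < μ.rowLen 0) :
    (j : ℤ) * (μ.colLen j - 1) < topEntry μ j - 1 := by
  induction j, hj using Nat.le_induction with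
  | base =>
    rw [topEntry_one]
    push_cast
    omega
  | succ j hj ih =>
    have h1 := ih (by omega)
    have h2 := topEntry_succ (μ := μ) (i := j) (by omega)
    have h3 : (μ.colLen (j + 1) : ℤ) ≤ μ.colLen j := by
      exact_mod_cast μ.colLen_anti j (j + 1) (by omega)
    push_cast
    zify at h2
    nlinarith

/-- The slopes of the lines from `(0, 1)` to the top cells decrease strictly if the first two
columns have different heights. -/
theorem topEntry_slope_lt {μ : YoungDiagram} (h : μ.colLen 1 < μ.colLen 0) {i j : ℕ}
    (hj : 1 ≤ j) (hji : j < i) (hi : i < μ.rowLen 0) :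
    ((topEntry μ i : ℤ) - 1) * j < ((topEntry μ j : ℤ) - 1) * i := by
  -- Each further column widens the gap by at least 1; the summand k records this and yields
  -- strictness, as i - j > 0.
  suffices H : ∀ k, j + k < μ.rowLen 0 →
      ((topEntry μ (j + k) : ℤ) - 1) * j + k ≤ ((topEntry μ j : ℤ) - 1) * (j + k) by
    have := H (i - j) (by omega)
    rw [show j + (i - j) = i by omega] at this
    zify [hji.le] at this
    have h' : (j : ℤ) < i := by exact_mod_cast hji
    nlinarith
  intro k
  induction k with
  | zero => simp
  | succ k ih =>
    intro hk
    have h1 := ih (by omega)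
    have h2 := topEntry_succ (μ := μ) (i := j + k) (by omega)
    have h3 := mul_colLen_sub_one_lt h hj (by omega)
    have h4 : (μ.colLen (j + k) : ℤ) ≤ μ.colLen j := by
      exact_mod_cast μ.colLen_anti j (j + k) (by omega)
    have h5 : (j : ℤ) * (μ.colLen (j + k) - 1) ≤ j * (μ.colLen j - 1) := by
      gcongr
    rw [← add_assoc j k 1]
    zify at h2
    have h6 : (topEntry μ (j + k + 1) : ℤ) = topEntry μ (j + k) + μ.colLen (j + k) - 1 := by
      linarith
    rw [h6]
    push_cast
    nlinarith

/-- In columns strictly between 0 and i the whole diagram lies strictly below the segment, by the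
slope inequality; columns from i on have no cell above row b_i. -/
theorem mem_weymanLabels_of_lt {μ : YoungDiagram} (h : μ.colLen 1 < μ.colLen 0) {i : ℕ}
    (hi : 1 ≤ i) (hi' : i < μ.rowLen 0) : (i, topEntry μ i) ∈ weymanLabels μ := by
  refine Or.inr ⟨hi, isTopWeymanCell_iff.2 ⟨hi', rfl⟩, fun j q hc h0 hne hseg => ?_⟩
  obtain ⟨hj, hq, -⟩ := isWeymanCell_iff.1 hc
  have hq1 : 1 ≤ q := (topEntry_pos hj.le).trans hq
  have hi0 : (0 : ℤ) < i := by exact_mod_cast hi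
  have key : 1 ≤ j → j < i → (j : ℤ) * ((topEntry μ i : ℤ) - 1) < ((q : ℤ) - 1) * i := by
    intro h1 h2
    have := topEntry_slope_lt h h1 h2 hi'
    have h3 : (topEntry μ j : ℤ) ≤ q := by exact_mod_cast hq
    nlinarith
  simp only [OnOrRightOfSegment] at hseg
  rcases hseg with ⟨hji, heq⟩ | ⟨-, hqp, hlt⟩
  · rcases Nat.eq_zero_or_pos j with rfl | hj0
    · simp only [Nat.cast_zero, zero_mul, mul_eq_zero] at heq
      exact h0 (by rw [show q = 1 by omega])
    · rcases hji.eq_or_lt with rfl | hlt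
      · rw [mul_comm] at heq
        have := mul_left_cancel₀ hi0.ne' heq
        exact hne (by rw [show q = topEntry μ j by omega])
      · exact absurd (key hj0 hlt) (by rw [heq]; exact lt_irrefl _)
  · rcases Nat.eq_zero_or_pos j with rfl | hj0
    · rw [Nat.cast_zero, zero_mul] at hlt
      have : (0 : ℤ) ≤ (q : ℤ) - 1 := by omega
      nlinarith
    · rcases lt_or_ge j i with hji | hij
      · exact absurd (key hj0 hji) (not_lt.2 hlt.le)
      · have := topEntry_mono hij hj.le
        omega

theorem zero_mem_weymanLabels {μ : YoungDiagram} {p : ℕ} (h1 : 1 ≤ p) (h2 : p ≤ μ.colLen 0) :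
    (0, p) ∈ weymanLabels μ :=
  Or.inl ⟨rfl, h1, h2⟩

theorem eq_of_mem_weymanLabels {μ : YoungDiagram} {i p : ℕ} (h : (i, p) ∈ weymanLabels μ) :
    (i = 0 ∧ 1 ≤ p ∧ p ≤ μ.colLen 0) ∨ (1 ≤ i ∧ i < μ.rowLen 0 ∧ p = topEntry μ i) := by
  rcases h with h | ⟨h1, h2, -⟩
  · exact Or.inl h
  · exact Or.inr ⟨h1, isTopWeymanCell_iff.1 h2⟩

theorem colLen_eq_countP (μ : YoungDiagram) (j : ℕ) :
    μ.colLen j = μ.rowLens.countP (j < ·) := by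
  have h : ∀ i, (j < μ.rowLen i) ↔ i < μ.colLen j := fun i => by
    rw [← YoungDiagram.mem_iff_lt_colLen, YoungDiagram.mem_iff_lt_rowLen]
  have key : ∀ k N : ℕ, (List.range N).countP (fun i => decide (i < k)) = min k N := fun k N => by
    induction N with
    | zero => simp
    | succ N ih =>
      rw [List.range_succ, List.countP_append, ih, List.countP_singleton]
      by_cases hk : N < k
      · rw [if_pos (by simpa using hk)]
        omega
      · rw [if_neg (by simpa using hk)]
        omega
  rw [YoungDiagram.rowLens, List.countP_map]
  simp only [Function.comp_def, h, key]
  exact (min_eq_left (μ.colLen_anti 0 j (Nat.zero_le j))).symm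

theorem colLen_firstColumns (μ : YoungDiagram) {k j : ℕ} (hj : j < k) :
    (firstColumns μ k).colLen j = μ.colLen j := by
  refine le_antisymm ?_ ?_ <;> refine le_of_forall_lt fun i hi => ?_
  · rw [← YoungDiagram.mem_iff_lt_colLen] at hi ⊢
    exact (Finset.mem_filter.1 hi).1
  · rw [← YoungDiagram.mem_iff_lt_colLen] at hi ⊢
    exact Finset.mem_filter.2 ⟨hi, hj⟩

/-- The column heights that the two families of the theorem have in common. -/
theorem colLen_of_family {μ : YoungDiagram} {g m l : ℕ}
    (hfam : (m = 2 ∧ IsFamilyOne g (firstColumns μ (l + 1))) ∨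
      (m = 3 ∧ IsFamilyTwo g (firstColumns μ (l + 1))))
    (hl : l < μ.rowLen 0) :
    m ≤ g ∧ μ.colLen 0 = g + 1 ∧ ∀ j, 1 ≤ j → j < l → μ.colLen j = g + 2 - m := by
  have hpos : 0 < (firstColumns μ (l + 1)).colLen l := by
    rw [colLen_firstColumns μ (Nat.lt_succ_self l)]
    exact colLen_pos_iff.2 hl
  rcases hfam with ⟨rfl, u, a, c, hu, rfl, hg, hrow⟩ | ⟨rfl, u, a, c, hu, rfl, hg, hrow⟩
  all_goals
    have key : ∀ j, j < l + 1 → μ.colLen j = _ := fun j hj => by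
      rw [← colLen_firstColumns μ hj, colLen_eq_countP, hrow]
    rw [colLen_eq_countP, hrow] at hpos
    simp only [List.countP_append, List.countP_replicate, List.countP_cons, List.countP_nil,
      decide_eq_true_eq] at key hpos
    -- Column l is nonempty, whereas all rows have length at most u.
    have hlu : l < u := by
      by_contra hlu
      rw [if_neg (by omega), if_neg (by omega), if_neg (by omega)] at hpos
      exact absurd hpos (by simp)
    refine ⟨by omega, ?_, fun j hj hjl => ?_⟩
    · rw [key 0 (by omega), if_pos (by omega), if_pos (by omega), if_pos (by omega)]
    -- Here j < l < u gives j < u - 1, so column j meets all long rows but no row of length 1.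
    -- Column l may be lower, but it does not enter b_i for i ≤ l.
    · rw [key j (by omega), if_pos (by omega), if_pos (by omega), if_neg (by omega)]
      omega

theorem topEntry_eq_of_colLen {μ : YoungDiagram} {s m l : ℕ} (hl : l < μ.rowLen 0)
    (h0 : μ.colLen 0 = s + m) (h1 : ∀ j, 1 ≤ j → j < l → μ.colLen j = s + 1) {i : ℕ}
    (hi : 1 ≤ i) (hil : i ≤ l) : topEntry μ i = i * s + m := by
  induction i, hi using Nat.le_induction with
  | base => rw [topEntry_one, h0, one_mul]
  | succ i hi ih =>
    have h2 := topEntry_succ (μ := μ) (i := i) (by omega)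
    rw [h1 i hi (by omega), ih (by omega)] at h2
    rw [add_mul]
    omega

end Diagrams

/-! ### Identities between partially symmetric polynomials. -/

section Esymm

variable {K : Type*} [Field K] {n : ℕ}

theorem partialEsymm_zero (S : Finset (Fin n)) : partialEsymm K S 0 = 1 := by
  simp [partialEsymm]

theorem partialEsymm_eq_zero {S : Finset (Fin n)} {r : ℕ} (h : S.card < r) :
    partialEsymm K S r = 0 := by
  simp [partialEsymm, Finset.powersetCard_eq_empty.2 h]

theorem partialEsymm_insert {S : Finset (Fin n)} {x : Fin n} (hx : x ∉ S) (r : ℕ) :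
    partialEsymm K (insert x S) (r + 1) = partialEsymm K S (r + 1) + X x * partialEsymm K S r := by
  have hmem : ∀ T ∈ S.powersetCard r, x ∉ T := fun T hT h =>
    hx ((Finset.mem_powersetCard.1 hT).1 h)
  rw [partialEsymm, Finset.powersetCard_succ_insert hx, Finset.sum_union, Finset.sum_image,
    partialEsymm, partialEsymm, Finset.mul_sum]
  · congr 1
    exact Finset.sum_congr rfl fun T hT => Finset.prod_insert (hmem T hT)
  · intro T hT T' hT' h
    rw [← Finset.erase_insert (hmem T hT), ← Finset.erase_insert (hmem T' hT')]
    exact congrArg (fun U => Finset.erase U x) h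
  · rw [Finset.disjoint_left]
    intro T hT hT'
    obtain ⟨U, -, rfl⟩ := Finset.mem_image.1 hT'
    exact hx ((Finset.mem_powersetCard.1 hT).1 (Finset.mem_insert_self x U))

theorem partialEsymm_erase {S : Finset (Fin n)} {x : Fin n} (hx : x ∈ S) (r : ℕ) :
    partialEsymm K S (r + 1) =
      partialEsymm K (S.erase x) (r + 1) + X x * partialEsymm K (S.erase x) r := by
  conv_lhs => rw [← Finset.insert_erase hx]
  exact partialEsymm_insert (Finset.notMem_erase x S) r

theorem sum_X_mul_partialEsymm_erase (S : Finset (Fin n)) (r : ℕ) :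
    ∑ x ∈ S, X x * partialEsymm K (S.erase x) r = ((r : MvPolynomial (Fin n) K) + 1) *
      partialEsymm K S (r + 1) := by
  induction S using Finset.induction_on generalizing r with
  | empty => rw [partialEsymm_eq_zero (by simp), mul_zero, Finset.sum_empty]
  | insert a S ha ih =>
    rw [Finset.sum_insert ha, Finset.erase_insert ha, partialEsymm_insert ha]
    have h : ∀ x ∈ S, (insert a S).erase x = insert a (S.erase x) := fun x hx =>
      Finset.erase_insert_of_ne (ne_of_mem_of_not_mem hx ha).symm
    rw [Finset.sum_congr rfl fun x hx => by rw [h x hx]]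
    cases r with
    | zero =>
      have := ih 0
      simp only [partialEsymm_zero] at this ⊢
      rw [this]
      push_cast
      ring
    | succ r =>
      have h2 : ∀ x ∈ S, X x * partialEsymm K (insert a (S.erase x)) (r + 1) =
          X x * partialEsymm K (S.erase x) (r + 1) +
            X a * (X x * partialEsymm K (S.erase x) r) := fun x hx => by
        rw [partialEsymm_insert fun h => ha (Finset.mem_of_mem_erase h)]
        ring
      rw [Finset.sum_congr rfl h2, Finset.sum_add_distrib, ← Finset.mul_sum, ih, ih]
      push_cast
      ring

theorem sum_partialEsymm_erase (S : Finset (Fin n)) (r : ℕ) :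
    ∑ x ∈ S, partialEsymm K (S.erase x) r =
      ((S.card : MvPolynomial (Fin n) K) - r) * partialEsymm K S r := by
  cases r with
  | zero => simp [partialEsymm_zero]
  | succ r =>
    have h : ∀ x ∈ S, partialEsymm K (S.erase x) (r + 1) =
        partialEsymm K S (r + 1) - X x * partialEsymm K (S.erase x) r := fun x hx => by
      rw [partialEsymm_erase hx]
      ring
    rw [Finset.sum_congr rfl h, Finset.sum_sub_distrib, sum_X_mul_partialEsymm_erase,
      Finset.sum_const, nsmul_eq_mul]
    push_cast
    ring

theorem partialEsymm_isHomogeneous (S : Finset (Fin n)) (r : ℕ) :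
    (partialEsymm K S r).IsHomogeneous r := by
  refine IsHomogeneous.sum _ _ _ fun T hT => ?_
  have := IsHomogeneous.prod T (fun i => (X i : MvPolynomial (Fin n) K)) (fun _ => 1)
    fun i _ => isHomogeneous_X K i
  simpa [(Finset.mem_powersetCard.1 hT).2] using this

theorem coeff_prod_one_add_X_mul (S : Finset (Fin n)) (r : ℕ) :
    (∏ x ∈ S, (1 + Polynomial.C (X x : MvPolynomial (Fin n) K) * Polynomial.X)).coeff r =
      partialEsymm K S r := by
  have h : ∏ x ∈ S, (1 + Polynomial.C (X x : MvPolynomial (Fin n) K) * Polynomial.X) =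
      ∑ r ∈ Finset.range (S.card + 1), Polynomial.C (partialEsymm K S r) * Polynomial.X ^ r := by
    rw [Finset.prod_one_add, Finset.sum_powerset]
    refine Finset.sum_congr rfl fun r _ => ?_
    rw [partialEsymm, map_sum, Finset.sum_mul]
    refine Finset.sum_congr rfl fun T hT => ?_
    rw [Finset.prod_mul_distrib, Finset.prod_const, (Finset.mem_powersetCard.1 hT).2, map_prod]
  rw [h, Polynomial.finsetSum_coeff]
  simp only [Polynomial.coeff_C_mul_X_pow]
  rw [Finset.sum_ite_eq, ite_eq_left_iff]
  intro hr
  rw [partialEsymm_eq_zero (by simpa using hr)]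

variable [CharZero K]

theorem mem_of_natCast_mul_mem {J : Ideal (MvPolynomial (Fin n) K)} {r : ℕ}
    {f : MvPolynomial (Fin n) K} (hr : r ≠ 0) (h : (r : MvPolynomial (Fin n) K) * f ∈ J) :
    f ∈ J := by
  have h2 := J.mul_mem_left (C ((r : K)⁻¹)) h
  rwa [← mul_assoc, ← map_natCast (C : K →+* MvPolynomial (Fin n) K), ← C_mul,
    inv_mul_cancel₀ (Nat.cast_ne_zero.2 hr), C_1, one_mul] at h2

/-- Averaging: the sum of e_r(S - x) over x ∈ S is (|S| - r) e_r(S), and |S| - r is invertible in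
characteristic 0. -/
theorem esymmSet_succ_card {J : Ideal (MvPolynomial (Fin n) K)} {r k : ℕ} (hrk : r ≤ k)
    (h : esymmSet K n r k ⊆ J) : esymmSet K n r (k + 1) ⊆ J := by
  rintro _ ⟨S, hS, rfl⟩
  refine mem_of_natCast_mul_mem (r := k + 1 - r) (by omega) ?_
  have := sum_partialEsymm_erase (K := K) S r
  rw [hS, ← Nat.cast_sub (by omega)] at this
  rw [← this]
  exact J.sum_mem fun x hx => h ⟨S.erase x, by rw [Finset.card_erase_of_mem hx, hS]; rfl, rfl⟩

theorem esymmSet_succ_succ {J : Ideal (MvPolynomial (Fin n) K)} {r k : ℕ}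
    (h : esymmSet K n r k ⊆ J) : esymmSet K n (r + 1) (k + 1) ⊆ J := by
  rintro _ ⟨S, hS, rfl⟩
  refine mem_of_natCast_mul_mem (r := r + 1) (by omega) ?_
  have := sum_X_mul_partialEsymm_erase (K := K) S r
  push_cast
  rw [← this]
  exact J.sum_mem fun x hx => J.mul_mem_left _
    (h ⟨S.erase x, by rw [Finset.card_erase_of_mem hx, hS]; rfl, rfl⟩)

/-- e_{r+1}(S) = e_{r+1}(S ∪ {x}) - x e_r(S) for some x outside S, which exists because k < n. -/
theorem esymmSet_succ_degree {J : Ideal (MvPolynomial (Fin n) K)} {r k : ℕ} (hk : k < n)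
    (h : esymmSet K n r k ⊆ J) : esymmSet K n (r + 1) k ⊆ J := by
  rintro _ ⟨S, hS, rfl⟩
  obtain ⟨x, hx⟩ : ∃ x, x ∉ S := by
    by_contra! hS'
    rw [Finset.eq_univ_iff_forall.2 hS', Finset.card_univ, Fintype.card_fin] at hS
    omega
  rw [← add_sub_cancel_right (partialEsymm K S (r + 1)) (X x * partialEsymm K S r),
    ← partialEsymm_insert hx]
  exact J.sub_mem (esymmSet_succ_succ h ⟨_, by rw [Finset.card_insert_of_notMem hx, hS], rfl⟩)
    (J.mul_mem_left _ (h ⟨S, hS, rfl⟩))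

theorem esymmSet_mono_degree {J : Ideal (MvPolynomial (Fin n) K)} {r r' k : ℕ} (hk : k < n)
    (hr : r ≤ r') (h : esymmSet K n r k ⊆ J) : esymmSet K n r' k ⊆ J := by
  induction r', hr using Nat.le_induction with
  | base => exact h
  | succ r' _ ih => exact esymmSet_succ_degree hk ih

end Esymm

/-! ### The reduced generating set. -/

section ReducedGenerators

variable {K : Type*} [Field K] {μ : YoungDiagram}

theorem esymmSet_subset_dpIdeal {i p : ℕ} (h : IsWeymanCell μ i p) :
    esymmSet K μ.card p (μ.card - i) ⊆ (dpIdeal K μ : Set (MvPolynomial (Fin μ.card) K)) := by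
  obtain ⟨hi, hp, hip⟩ := isWeymanCell_iff.1 h
  have := topEntry_pos hi.le
  exact fun f hf => Ideal.subset_span ⟨μ.card - i, p, by omega, by omega, by omega, h.2, hf⟩

theorem columnGens_subset_dpIdeal (hμ : 2 ≤ μ.rowLen 0) (j : ℕ) :
    columnGens K μ j ⊆ (dpIdeal K μ : Set (MvPolynomial (Fin μ.card) K)) := by
  have hc := rowLen_zero_le_card μ
  rintro f ((⟨rfl, r, hr, hr', hf⟩ | ⟨-, h1, -⟩) | ⟨h, hf⟩)
  · have h1 := topEntry_add_le_card (μ := μ) (i := 1) (by omega)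
    refine esymmSet_subset_dpIdeal (i := 0)
      (isWeymanCell_iff.2 ⟨by omega, ?_, by omega⟩) hf
    rwa [topEntry_zero]
  · omega
  · have hj : j < μ.rowLen 0 := by
      rcases h with ⟨-, h⟩ | ⟨h, -⟩
      · exact colLen_pos_iff.1 (by omega)
      · omega
    exact esymmSet_subset_dpIdeal (isWeymanCell_iff.2 ⟨hj, le_rfl, topEntry_add_le_card hj⟩) hf

variable [CharZero K]

/-- The symmetric polynomials of degree at least b_1 come from column 1: degree b_1 by averaging,
higher degrees from e_{r-1}(n - 1). -/
theorem esymmSet_univ_subset (hμ : 2 ≤ μ.rowLen 0) {J : Ideal (MvPolynomial (Fin μ.card) K)}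
    (h0 : ∀ r, 1 ≤ r → r < topEntry μ 1 → esymmSet K μ.card r μ.card ⊆ J)
    (h1 : esymmSet K μ.card (topEntry μ 1) (μ.card - 1) ⊆ J) {r : ℕ} (hr : 1 ≤ r) :
    esymmSet K μ.card r μ.card ⊆ J := by
  have hc := rowLen_zero_le_card μ
  have hb := topEntry_add_le_card (μ := μ) (i := 1) (by omega)
  have hn : μ.card - 1 + 1 = μ.card := by omega
  rcases lt_trichotomy r (topEntry μ 1) with h | rfl | h
  · exact h0 r hr h
  · have := esymmSet_succ_card (by omega) h1
    rwa [hn] at this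
  · have := esymmSet_succ_succ (esymmSet_mono_degree (by omega)
      (show topEntry μ 1 ≤ r - 1 by omega) h1)
    rwa [hn, Nat.sub_add_cancel hr] at this

/-- In a column i ≥ 1 the top entry yields all entries below it, since degrees can be raised within
e_r(n - i). -/
theorem dpIdeal_le (hμ : 2 ≤ μ.rowLen 0) {J : Ideal (MvPolynomial (Fin μ.card) K)}
    (h0 : ∀ r, 1 ≤ r → r < topEntry μ 1 → esymmSet K μ.card r μ.card ⊆ J)
    (h : ∀ i, 1 ≤ i → i < μ.rowLen 0 → esymmSet K μ.card (topEntry μ i) (μ.card - i) ⊆ J) :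
    dpIdeal K μ ≤ J := by
  have hc := rowLen_zero_le_card μ
  refine Ideal.span_le.2 ?_
  rintro f ⟨k, r, hk, hkn, hrk, hkr, hf⟩
  have hk' : μ.card - (μ.card - k) = k := Nat.sub_sub_self hkn
  obtain ⟨hi, hr, -⟩ := (isWeymanCell_iff (μ := μ) (i := μ.card - k) (p := r)).1
    ⟨by omega, by rwa [hk']⟩
  rcases Nat.eq_zero_or_pos (μ.card - k) with h1 | h1
  · rw [h1, topEntry_zero] at hr
    rw [show k = μ.card by omega] at hf
    exact esymmSet_univ_subset hμ h0 (h 1 le_rfl (by omega)) hr hf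
  · have := esymmSet_mono_degree (by omega) hr (h _ h1 hi)
    rw [hk'] at this
    exact this hf

theorem span_columnGens (hμ : 2 ≤ μ.rowLen 0) :
    Ideal.span (⋃ j, columnGens K μ j) = dpIdeal K μ := by
  refine le_antisymm (Ideal.span_le.2 (Set.iUnion_subset fun j =>
    columnGens_subset_dpIdeal hμ j)) (dpIdeal_le hμ ?_ ?_)
  · intro r hr hr' f hf
    exact Ideal.subset_span (Set.mem_iUnion.2 ⟨0, Or.inl (Or.inl ⟨rfl, r, hr, hr', hf⟩)⟩)
  -- Downward induction on the column, starting from the last one, whose generator is always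
  -- present.
  · suffices H : ∀ k i, i + k + 1 = μ.rowLen 0 → 1 ≤ i →
        esymmSet K μ.card (topEntry μ i) (μ.card - i) ⊆
          (Ideal.span (⋃ j, columnGens K μ j) : Set (MvPolynomial (Fin μ.card) K)) from
      fun i hi hi' => H (μ.rowLen 0 - i - 1) i (by omega) hi
    intro k
    induction k with
    | zero =>
      intro i hi hi1 f hf
      exact Ideal.subset_span (Set.mem_iUnion.2 ⟨i, Or.inr ⟨Or.inr ⟨hi, Or.inl hi1⟩, hf⟩⟩)
    | succ k ih =>
      intro i hi hi1
      by_cases hc : 2 ≤ μ.colLen i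
      · exact fun f hf => Ideal.subset_span
          (Set.mem_iUnion.2 ⟨i, Or.inr ⟨Or.inl ⟨hi1, hc⟩, hf⟩⟩)
      -- A column of height 1 has b_{i+1} = b_i, so its top entry is obtained by averaging that of
      -- the next column.
      · have h1 := colLen_pos_iff.2 (show i < μ.rowLen 0 by omega)
        have h2 := topEntry_succ (show i < μ.rowLen 0 by omega)
        have h3 := topEntry_add_le_card (show i + 1 < μ.rowLen 0 by omega)
        have h4 := esymmSet_succ_card (by omega) (ih (i + 1) (by omega) (by omega))
        rwa [show μ.card - (i + 1) + 1 = μ.card - i by omega,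
          show topEntry μ (i + 1) = topEntry μ i by omega] at h4

end ReducedGenerators

/-! ### Products of truncated geometric series. -/

section TruncatedSeries

open Polynomial in
/-- The geometric series `∑ (y t)^a`, truncated to `a < N`. -/
def truncGeom {A : Type*} [CommRing A] (N : ℕ) (y : A) : A[X] :=
  ∑ a ∈ Finset.range N, (Polynomial.C y * Polynomial.X) ^ a

open Polynomial in
/-- The part of the truncated geometric series in the degrees `s + 1, …, s + d`. -/
def geomTail {A : Type*} [CommRing A] (s d : ℕ) (y : A) : A[X] :=
  ∑ a ∈ Finset.range d, (Polynomial.C y * Polynomial.X) ^ (s + 1 + a)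

variable {A ι : Type*} [CommRing A] {s d : ℕ}

theorem truncGeom_eq_add (y : A) :
    truncGeom (s + 1 + d) y = truncGeom (s + 1) y + geomTail s d y := by
  rw [truncGeom, Finset.sum_range_add]
  rfl

theorem natDegree_C_mul_X_pow_le' (y : A) (a : ℕ) :
    ((Polynomial.C y * Polynomial.X) ^ a).natDegree ≤ a := by
  rw [mul_pow, ← Polynomial.C_pow]
  exact Polynomial.natDegree_C_mul_X_pow_le _ _

theorem natDegree_truncGeom_le (y : A) : (truncGeom (s + 1) y).natDegree ≤ s :=
  Polynomial.natDegree_sum_le_of_forall_le _ _ fun a ha =>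
    (natDegree_C_mul_X_pow_le' y a).trans (Nat.lt_succ_iff.1 (Finset.mem_range.1 ha))

theorem natDegree_geomTail_le (y : A) : (geomTail s d y).natDegree ≤ s + d :=
  Polynomial.natDegree_sum_le_of_forall_le _ _ fun a ha => by
    have := natDegree_C_mul_X_pow_le' y (s + 1 + a)
    have := Finset.mem_range.1 ha
    omega

variable {y : ι → A}

theorem natDegree_prod_geomTail_le_of_card_le_one {T : Finset ι} (h : T.card ≤ 1) :
    (∏ x ∈ T, geomTail s d (y x)).natDegree ≤ T.card * s + d := by
  rcases Nat.le_one_iff_eq_zero_or_eq_one.1 h with h0 | h1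
  · rw [Finset.card_eq_zero.1 h0]
    simp
  · obtain ⟨x, rfl⟩ := Finset.card_eq_one.1 h1
    simpa using natDegree_geomTail_le (y x)

theorem prod_geomTail_eq_zero_of_subset {T U : Finset ι} (hTU : T ⊆ U)
    (h : ∏ x ∈ T, geomTail s d (y x) = 0) : ∏ x ∈ U, geomTail s d (y x) = 0 :=
  zero_dvd_iff.1 (h ▸ Finset.prod_dvd_prod_of_subset T U _ hTU)

theorem one_sub_mul_truncGeom {N : ℕ} {z : A} (hz : z ^ N = 0) :
    (1 - Polynomial.C z * Polynomial.X) * truncGeom N z = 1 := by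
  rw [truncGeom, mul_neg_geom_sum, mul_pow, ← Polynomial.C_pow, hz, Polynomial.C_0, zero_mul,
    sub_zero]

variable [DecidableEq ι]

/-- The product over all x is 1, so the product over the complement of S inverts the one over S;
nilpotency makes the inverse factors polynomials. -/
theorem prod_compl_one_sub_eq [Fintype ι] {N : ℕ} (hN : ∀ x, y x ^ N = 0)
    (h : ∏ x, (1 - Polynomial.C (y x) * Polynomial.X) = 1) (S : Finset ι) :
    ∏ x ∈ Sᶜ, (1 - Polynomial.C (y x) * Polynomial.X) = ∏ x ∈ S, truncGeom N (y x) := by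
  calc _ = (∏ x ∈ Sᶜ, (1 - Polynomial.C (y x) * Polynomial.X)) *
      ∏ x ∈ S, ((1 - Polynomial.C (y x) * Polynomial.X) * truncGeom N (y x)) := by
        rw [Finset.prod_congr rfl fun x _ => one_sub_mul_truncGeom (hN x), Finset.prod_const_one,
          mul_one]
    _ = _ := by
        rw [Finset.prod_mul_distrib, ← mul_assoc, Finset.prod_compl_mul_prod, h, one_mul]

theorem natDegree_prod_tail_mul_le {S T : Finset ι} (hT : T ⊆ S)
    (h : (∏ x ∈ T, geomTail s d (y x)).natDegree ≤ T.card * s + d) :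
    ((∏ x ∈ T, geomTail s d (y x)) * ∏ x ∈ S \ T, truncGeom (s + 1) (y x)).natDegree ≤
      S.card * s + d := by
  have h1 : (∏ x ∈ S \ T, truncGeom (s + 1) (y x)).natDegree ≤ (S \ T).card * s := by
    refine (Polynomial.natDegree_prod_le _ _).trans ?_
    rw [← smul_eq_mul]
    exact Finset.sum_le_card_nsmul _ _ _ fun x _ => natDegree_truncGeom_le _
  refine Polynomial.natDegree_mul_le.trans ((add_le_add h h1).trans ?_)
  rw [← Finset.card_sdiff_add_card_eq_card hT, add_mul]
  omega

/-- Expand each factor as tail plus a part of degree at most s. The term of T has degree at most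
deg(∏ tails over T) + |S - T| s, too small for every proper subset T. -/
theorem coeff_prod_truncGeom_eq {S : Finset ι}
    (h : ∀ T, T ⊂ S → (∏ x ∈ T, geomTail s d (y x)).natDegree ≤ T.card * s + d) :
    (∏ x ∈ S, truncGeom (s + 1 + d) (y x)).coeff (S.card * s + (d + 1)) =
      (∏ x ∈ S, geomTail s d (y x)).coeff (S.card * s + (d + 1)) := by
  simp only [truncGeom_eq_add, add_comm (truncGeom (s + 1) _)]
  rw [Finset.prod_add, Polynomial.finsetSum_coeff, Finset.sum_eq_single S]
  · simp
  · intro T hT hne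
    have hT' := Finset.mem_powerset.1 hT
    refine Polynomial.coeff_eq_zero_of_natDegree_lt ?_
    have := natDegree_prod_tail_mul_le hT' (h T (hT'.ssubset_of_ne hne))
    omega
  · intro h
    exact absurd (Finset.mem_powerset_self S) h

theorem coeff_prod_truncGeom_eq_zero {S : Finset ι}
    (h : ∀ T, T ⊆ S → (∏ x ∈ T, geomTail s d (y x)).natDegree ≤ T.card * s + d) :
    (∏ x ∈ S, truncGeom (s + 1 + d) (y x)).coeff (S.card * s + (d + 1)) = 0 := by
  rw [coeff_prod_truncGeom_eq fun T hT => h T hT.subset]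
  refine Polynomial.coeff_eq_zero_of_natDegree_lt ?_
  have := h S subset_rfl
  omega

/-- A tail is the single term (y t)^(s+1), so the relation for pairs says that any two tails
multiply to 0; a set T with at most one element has too small a degree. -/
theorem coeff_prod_truncGeom_two
    (h2 : ∀ T : Finset ι, T.card = 2 → (∏ x ∈ T, truncGeom (s + 2) (y x)).coeff (2 * s + 2) = 0)
    (S : Finset ι) : (∏ x ∈ S, truncGeom (s + 2) (y x)).coeff (S.card * s + 2) = 0 := by
  have hpair : ∀ T : Finset ι, T.card = 2 → ∏ x ∈ T, geomTail s 1 (y x) = 0 := fun T hT => by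
    have h := coeff_prod_truncGeom_eq (s := s) (d := 1) (y := y) (S := T) fun U hU =>
      natDegree_prod_geomTail_le_of_card_le_one (by have := Finset.card_lt_card hU; omega)
    rw [hT] at h
    rw [h2 T hT] at h
    obtain ⟨i, j, hij, rfl⟩ := Finset.card_eq_two.1 hT
    rw [Finset.prod_pair hij] at h ⊢
    simp only [geomTail, Finset.sum_range_one, add_zero, mul_pow, ← Polynomial.C_pow] at h ⊢
    have e : ∀ a b : A, Polynomial.C a * Polynomial.X ^ (s + 1) *
        (Polynomial.C b * Polynomial.X ^ (s + 1)) =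
        Polynomial.C (a * b) * Polynomial.X ^ (2 * s + (1 + 1)) := fun a b => by
      rw [Polynomial.C_mul]
      ring
    rw [e, Polynomial.coeff_C_mul_X_pow, if_pos rfl] at h
    rw [e, ← h, Polynomial.C_0, zero_mul]
  refine coeff_prod_truncGeom_eq_zero (d := 1) fun T _ => ?_
  rcases Nat.lt_or_ge T.card 2 with h | h
  · exact natDegree_prod_geomTail_le_of_card_le_one (by omega)
  · obtain ⟨U, hU, hU'⟩ := Finset.exists_subset_card_eq h
    rw [prod_geomTail_eq_zero_of_subset hU (hpair U hU')]
    simp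

theorem geomTail_two (z : A) : geomTail s 2 z = Polynomial.C (z ^ (s + 1)) * Polynomial.X ^ (s + 1) +
    Polynomial.C (z ^ (s + 2)) * Polynomial.X ^ (s + 2) := by
  simp only [geomTail, Finset.sum_range_succ, Finset.sum_range_zero, zero_add, add_zero, mul_pow,
    ← Polynomial.C_pow]

/-- The relation for pairs leaves only the term of degree 2s + 2 in a product of two tails, which is
still too small to matter. A product of three tails is then a multiple of its coefficient in degree
3s + 3, which the relation for triples kills. -/
theorem coeff_prod_truncGeom_three (h1 : ∀ x, y x ^ (s + 3) = 0)
    (h2 : ∀ T : Finset ι, T.card = 2 → (∏ x ∈ T, truncGeom (s + 3) (y x)).coeff (2 * s + 3) = 0)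
    (h3 : ∀ T : Finset ι, T.card = 3 → (∏ x ∈ T, truncGeom (s + 3) (y x)).coeff (3 * s + 3) = 0)
    (S : Finset ι) : (∏ x ∈ S, truncGeom (s + 3) (y x)).coeff (S.card * s + 3) = 0 := by
  have hpair : ∀ i j, i ≠ j → geomTail s 2 (y i) * geomTail s 2 (y j) =
      Polynomial.C (y i ^ (s + 1) * y j ^ (s + 1)) * Polynomial.X ^ (2 * s + 2) := fun i j hij => by
    have h := coeff_prod_truncGeom_eq (s := s) (d := 2) (y := y) (S := {i, j}) fun U hU =>
      natDegree_prod_geomTail_le_of_card_le_one (by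
        have := Finset.card_lt_card hU
        rw [Finset.card_pair hij] at this
        omega)
    rw [Finset.card_pair hij] at h
    rw [h2 _ (Finset.card_pair hij), Finset.prod_pair hij] at h
    have e : geomTail s 2 (y i) * geomTail s 2 (y j) =
        Polynomial.C (y i ^ (s + 1) * y j ^ (s + 1)) * Polynomial.X ^ (2 * s + 2) +
        Polynomial.C (y i ^ (s + 1) * y j ^ (s + 1) * (y i + y j)) * Polynomial.X ^ (2 * s + 3) +
        Polynomial.C (y i ^ (s + 2) * y j ^ (s + 2)) * Polynomial.X ^ (2 * s + 4) := by
      simp only [geomTail_two, map_mul, map_add, map_pow]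
      ring
    rw [e] at h ⊢
    simp only [Polynomial.coeff_add, Polynomial.coeff_C_mul_X_pow] at h
    rw [if_neg (by omega), if_pos trivial, if_neg (by omega), zero_add, add_zero] at h
    -- Multiply the relation (y_i y_j)^(s+1) (y_i + y_j) = 0 by y_j and use y_j^(s+3) = 0.
    have h' : y i ^ (s + 2) * y j ^ (s + 2) = 0 := by
      have e1 : y i ^ (s + 2) * y j ^ (s + 2) =
          y j * (y i ^ (s + 1) * y j ^ (s + 1) * (y i + y j)) - y i ^ (s + 1) * y j ^ (s + 3) := by
        ring
      rw [e1, ← h, h1, mul_zero, mul_zero, sub_zero]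
    rw [← h, h']
    simp
  have hle2 : ∀ T : Finset ι, T.card ≤ 2 →
      (∏ x ∈ T, geomTail s 2 (y x)).natDegree ≤ T.card * s + 2 := fun T hT => by
    rcases hT.lt_or_eq with h | h
    · exact natDegree_prod_geomTail_le_of_card_le_one (by omega)
    · obtain ⟨i, j, hij, rfl⟩ := Finset.card_eq_two.1 h
      rw [Finset.prod_pair hij, hpair i j hij, h]
      exact Polynomial.natDegree_C_mul_X_pow_le _ _
  have htriple : ∀ T : Finset ι, T.card = 3 → ∏ x ∈ T, geomTail s 2 (y x) = 0 := fun T hT => by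
    have h := coeff_prod_truncGeom_eq (s := s) (d := 2) (y := y) (S := T) fun U hU =>
      hle2 U (by have := Finset.card_lt_card hU; omega)
    rw [hT] at h
    rw [h3 _ hT] at h
    obtain ⟨i, j, k, hij, hik, hjk, rfl⟩ := Finset.card_eq_three.1 hT
    have e : ∏ x ∈ {i, j, k}, geomTail s 2 (y x) =
        Polynomial.C (y i ^ (s + 1) * y j ^ (s + 1) * y k ^ (s + 1)) *
            Polynomial.X ^ (3 * s + 3) +
          Polynomial.C (y i ^ (s + 1) * y j ^ (s + 1) * y k ^ (s + 1) * y k) *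
            Polynomial.X ^ (3 * s + 4) := by
      rw [Finset.prod_insert (by simp [hij, hik]), Finset.prod_pair hjk, ← mul_assoc,
        hpair i j hij, geomTail_two]
      simp only [map_mul, map_pow]
      ring
    rw [e] at h ⊢
    simp only [Polynomial.coeff_add, Polynomial.coeff_C_mul_X_pow] at h
    rw [if_pos trivial, if_neg (by omega), add_zero] at h
    rw [← h]
    simp
  refine coeff_prod_truncGeom_eq_zero (d := 2) fun T _ => ?_
  rcases Nat.lt_or_ge T.card 3 with h | h
  · exact hle2 T (by omega)
  · obtain ⟨U, hU, hU'⟩ := Finset.exists_subset_card_eq h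
    rw [prod_geomTail_eq_zero_of_subset hU (htriple U hU')]
    simp

end TruncatedSeries

/-! ### Redundancy of the generators on a line. -/

section Redundancy

variable {K : Type*} [Field K] {n : ℕ} {J : Ideal (MvPolynomial (Fin n) K)}

theorem partialEsymm_univ_mem (hsym : ∀ r, 1 ≤ r → esymmSet K n r n ⊆ J) {r : ℕ} (hr : 1 ≤ r) :
    partialEsymm K (Finset.univ : Finset (Fin n)) r ∈ J :=
  hsym r hr ⟨Finset.univ, by simp, rfl⟩

/-- Modulo the symmetric polynomials, e_{r+1}(n) = 0 reads e_{r+1}(S) = -x e_r(S) for S the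
complement of x. -/
theorem mk_partialEsymm_univ_erase (hsym : ∀ r, 1 ≤ r → esymmSet K n r n ⊆ J) (x : Fin n)
    (r : ℕ) : Ideal.Quotient.mk J (partialEsymm K (Finset.univ.erase x) r) =
      (-Ideal.Quotient.mk J (X x)) ^ r := by
  induction r with
  | zero => rw [partialEsymm_zero, map_one, pow_zero]
  | succ r ih =>
    have h := Ideal.Quotient.eq_zero_iff_mem.2
      (partialEsymm_univ_mem hsym (show 1 ≤ r + 1 by omega))
    rw [partialEsymm_erase (Finset.mem_univ x), map_add, map_mul, ih] at h
    rw [eq_neg_of_add_eq_zero_left h]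
    ring

theorem mk_partialEsymm_compl (hsym : ∀ r, 1 ≤ r → esymmSet K n r n ⊆ J) {N : ℕ}
    (hN : ∀ x, (-Ideal.Quotient.mk J (X x)) ^ N = 0) (S : Finset (Fin n)) (r : ℕ) :
    Ideal.Quotient.mk J (partialEsymm K Sᶜ r) =
      (∏ x ∈ S, truncGeom N (-Ideal.Quotient.mk J (X x))).coeff r := by
  have hmap : ∀ T : Finset (Fin n), (∏ x ∈ T, (1 - Polynomial.C (-Ideal.Quotient.mk J (X x)) *
      Polynomial.X)) = Polynomial.map (Ideal.Quotient.mk J)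
        (∏ x ∈ T, (1 + Polynomial.C (X x : MvPolynomial (Fin n) K) * Polynomial.X)) := fun T => by
    simp [Polynomial.map_prod]
  rw [← prod_compl_one_sub_eq hN, hmap, Polynomial.coeff_map, coeff_prod_one_add_X_mul]
  ext r
  rw [hmap, Polynomial.coeff_map, coeff_prod_one_add_X_mul, Polynomial.coeff_one]
  split_ifs with h
  · rw [h, partialEsymm_zero, map_one]
  · exact Ideal.Quotient.eq_zero_iff_mem.2 (partialEsymm_univ_mem hsym (by omega))

/-- Generators on the line through `(0, m)`, `m = 2` or `3`: those of the columns `1, …, m` and the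
symmetric polynomials suffice. -/
theorem esymmSet_line_subset {s m : ℕ} (hm : m = 2 ∨ m = 3)
    (hsym : ∀ r, 1 ≤ r → esymmSet K n r n ⊆ J)
    (h : ∀ j, 1 ≤ j → j ≤ m → esymmSet K n (j * s + m) (n - j) ⊆ J) {k : ℕ} (hk : k ≤ n) :
    esymmSet K n (k * s + m) (n - k) ⊆ J := by
  -- The generators of column 1 are, modulo J, the powers (-x)^(s+m).
  have hN : ∀ x, (-Ideal.Quotient.mk J (X x)) ^ (s + m) = 0 := fun x => by
    rw [← mk_partialEsymm_univ_erase hsym, Ideal.Quotient.eq_zero_iff_mem]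
    have h1 := h 1 le_rfl (by omega)
    rw [one_mul] at h1
    exact h1 ⟨_, by rw [Finset.card_erase_of_mem (Finset.mem_univ x)]; simp, rfl⟩
  have hT : ∀ j, 1 ≤ j → j ≤ m → ∀ T : Finset (Fin n), T.card = j →
      (∏ x ∈ T, truncGeom (s + m) (-Ideal.Quotient.mk J (X x))).coeff (j * s + m) = 0 := by
    intro j hj hjm T hT
    rw [← mk_partialEsymm_compl hsym hN, Ideal.Quotient.eq_zero_iff_mem]
    exact h j hj hjm ⟨Tᶜ, by rw [Finset.card_compl, hT, Fintype.card_fin], rfl⟩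
  rintro _ ⟨S, hS, rfl⟩
  have hS' : Sᶜ.card = k := by
    rw [Finset.card_compl, hS, Fintype.card_fin]
    omega
  have hc := mk_partialEsymm_compl hsym hN Sᶜ (k * s + m)
  rw [compl_compl] at hc
  refine Ideal.Quotient.eq_zero_iff_mem.1 (hc.trans ?_)
  rw [← hS']
  rcases hm with rfl | rfl
  · exact coeff_prod_truncGeom_two (hT 2 (by omega) le_rfl) _
  · exact coeff_prod_truncGeom_three hN (hT 2 (by omega) (by omega)) (hT 3 (by omega) le_rfl) _

end Redundancy

/-! ### Minors of the generic diagonal matrix. -/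

section DiagonalMinors

variable {K : Type*} [Field K] {n : ℕ}

/-- The minor with rows `r` and columns `s` of the generic diagonal matrix. -/
def diagMinor (K : Type*) [Field K] {n : ℕ} {κ : Type*} [Fintype κ] [DecidableEq κ]
    (r s : κ → Fin n) : MvPolynomial (Fin n) K :=
  (Matrix.of fun k l => if r k = s l then (X (r k) : MvPolynomial (Fin n) K) else 0).det

variable {κ : Type*} [Fintype κ] [DecidableEq κ]

theorem diagMinor_eq_zero_of_not_injective {r : κ → Fin n} (s : κ → Fin n)
    (h : ¬ Function.Injective r) : diagMinor K r s = 0 := by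
  simp only [Function.Injective, not_forall] at h
  obtain ⟨k, l, hkl, hne⟩ := h
  exact Matrix.det_zero_of_row_eq hne (by ext; simp [hkl])

theorem diagMinor_eq_zero_of_notMem {r s : κ → Fin n} (k : κ) (h : ∀ l, r k ≠ s l) :
    diagMinor K r s = 0 :=
  Matrix.det_eq_zero_of_row_eq_zero k fun l => by simp [h l]

theorem diagMinor_self {r : κ → Fin n} (h : Function.Injective r) :
    diagMinor K r r = ∏ k, X (r k) := by
  rw [diagMinor, ← Matrix.det_diagonal]
  congr 1
  ext k l
  simp [Matrix.diagonal_apply, h.eq_iff]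

theorem diagMinor_comp_perm (r s : κ → Fin n) (σ : Equiv.Perm κ) :
    diagMinor K r (s ∘ σ) = (Equiv.Perm.sign σ : ℤ) * diagMinor K r s := by
  rw [diagMinor, diagMinor, ← Matrix.det_permute']
  rfl

theorem restrictDiag_minorSum {i : ℕ} (q : ℕ) (a b : Fin i → Fin n) :
    restrictDiag K n (minorSum K q a b) =
      ∑ d : Fin q → Fin n, diagMinor K (Sum.elim a d) (Sum.elim b d) := by
  rw [minorSum, map_sum]
  refine Finset.sum_congr rfl fun d _ => ?_
  rw [AlgHom.map_det, diagMinor]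
  congr 1
  ext1 k l
  simp [restrictDiag, Matrix.mvPolynomialX_apply]

theorem restrictDiag_minorSum_comp_perm {i : ℕ} (q : ℕ) (a b : Fin i → Fin n)
    (σ : Equiv.Perm (Fin i)) : restrictDiag K n (minorSum K q a (b ∘ σ)) =
      (Equiv.Perm.sign σ : ℤ) * restrictDiag K n (minorSum K q a b) := by
  rw [restrictDiag_minorSum, restrictDiag_minorSum, Finset.mul_sum]
  refine Finset.sum_congr rfl fun d _ => ?_
  have h : Sum.elim (b ∘ σ) d = Sum.elim b d ∘ (Equiv.sumCongr σ (1 : Equiv.Perm (Fin q))) := by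
    ext (k | k) <;> rfl
  rw [h, diagMinor_comp_perm, Equiv.Perm.sign_sumCongr, map_one, mul_one]

/-- The row of a_k could be nonzero only through some d_l = a_k, but then two rows coincide. -/
theorem restrictDiag_minorSum_eq_zero {i : ℕ} (q : ℕ) {a b : Fin i → Fin n} (k : Fin i)
    (h : ∀ l, a k ≠ b l) : restrictDiag K n (minorSum K q a b) = 0 := by
  rw [restrictDiag_minorSum]
  refine Finset.sum_eq_zero fun d _ => ?_
  by_cases hinj : Function.Injective (Sum.elim a d)
  · refine diagMinor_eq_zero_of_notMem (Sum.inl k) ?_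
    rintro (l | l)
    · exact h l
    · exact fun he => Sum.inl_ne_inr (hinj (a₁ := Sum.inl k) (a₂ := Sum.inr l) he)
  · exact diagMinor_eq_zero_of_not_injective _ hinj

/-- Every set with `q` elements is the image of `q!` injective maps from `Fin q`. -/
theorem sum_injective_image {α M : Type*} [Fintype α] [DecidableEq α] [AddCommMonoid M]
    (q : ℕ) (S : Finset α) (F : Finset α → M) :
    ∑ d : Fin q → α with Function.Injective d ∧ ∀ k, d k ∈ S, F (Finset.univ.image d) =
      q.factorial • ∑ T ∈ S.powersetCard q, F T := by
  rw [← Finset.sum_fiberwise_of_maps_to (t := S.powersetCard q)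
    (g := fun d => Finset.univ.image d), Finset.smul_sum]
  · refine Finset.sum_congr rfl fun T hT => ?_
    obtain ⟨hTS, hTc⟩ := Finset.mem_powersetCard.1 hT
    rw [Finset.sum_congr rfl fun d hd => by rw [(Finset.mem_filter.1 hd).2], Finset.sum_const]
    congr 1
    have e : Fin q ≃ T := Fintype.equivOfCardEq (by simp [hTc])
    have hc : (Finset.univ : Finset (Fin q ≃ T)).card = q.factorial := by
      rw [Finset.card_univ, Fintype.card_equiv e, Fintype.card_fin]
    rw [← hc]
    symm
    refine Finset.card_bij (fun f _ k => (f k : α)) ?_ ?_ ?_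
    · intro f _
      simp only [Finset.mem_filter, Finset.mem_univ, true_and]
      refine ⟨⟨fun k l h => f.injective (Subtype.ext h), fun k => hTS (f k).2⟩, ?_⟩
      ext x
      simp only [Finset.mem_image, Finset.mem_univ, true_and]
      exact ⟨fun ⟨k, hk⟩ => hk ▸ (f k).2, fun hx => ⟨f.symm ⟨x, hx⟩, by simp⟩⟩
    · intro f _ g _ h
      exact Equiv.ext fun k => Subtype.ext (congrFun h k)
    · intro d hd
      simp only [Finset.mem_filter, Finset.mem_univ, true_and] at hd
      obtain ⟨⟨hinj, -⟩, rfl⟩ := hd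
      exact ⟨Equiv.ofBijective (fun k => ⟨d k, Finset.mem_image_of_mem d (Finset.mem_univ k)⟩)
        ((Fintype.bijective_iff_injective_and_card _).2
          ⟨fun k l h => hinj (congrArg Subtype.val h), by rw [Fintype.card_coe, hTc, Fintype.card_fin]⟩), Finset.mem_univ _, rfl⟩
  · intro d hd
    obtain ⟨hinj, hS⟩ := (Finset.mem_filter.1 hd).2
    refine Finset.mem_powersetCard.2 ⟨?_, ?_⟩
    · exact Finset.image_subset_iff.2 fun k _ => hS k
    · rw [Finset.card_image_of_injective _ hinj, Finset.card_univ, Fintype.card_fin]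

theorem restrictDiag_minorSum_self {i : ℕ} (q : ℕ) {a : Fin i → Fin n}
    (ha : Function.Injective a) : restrictDiag K n (minorSum K q a a) =
      q.factorial • ((∏ k, X (a k)) * partialEsymm K (Finset.univ.image a)ᶜ q) := by
  have h1 : ∀ d : Fin q → Fin n, diagMinor K (Sum.elim a d) (Sum.elim a d) =
      if Function.Injective d ∧ ∀ k, d k ∈ (Finset.univ.image a)ᶜ then
        (∏ k, X (a k)) * ∏ t ∈ Finset.univ.image d, X t else 0 := fun d => by
    have hiff : Function.Injective (Sum.elim a d) ↔
        Function.Injective d ∧ ∀ k, d k ∈ (Finset.univ.image a)ᶜ := by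
      rw [Sum.elim_injective]
      simp only [ha, true_and, Finset.mem_compl, Finset.mem_image, Finset.mem_univ, not_exists]
      exact and_congr_right fun _ => forall_comm
    split_ifs with h
    · rw [diagMinor_self (hiff.2 h), Fintype.prod_sum_type, Finset.prod_image h.1.injOn]
      rfl
    · exact diagMinor_eq_zero_of_not_injective _ (mt hiff.1 h)
  rw [restrictDiag_minorSum, Finset.sum_congr rfl fun d _ => h1 d, ← Finset.sum_filter,
    sum_injective_image q _ fun T => (∏ k, X (a k)) * ∏ t ∈ T, (X t : MvPolynomial (Fin n) K),
    ← Finset.mul_sum]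
  rfl

end DiagonalMinors

/-! ### Restricting Weyman's polynomials to diagonal matrices. -/

section TracelessTensors

variable {K : Type*} [Field K] [CharZero K] {n i : ℕ}
  {c : (Fin i → Fin n) → (Fin i → Fin n) → K}

theorem IsTracelessAlternating.eq_zero_of_not_injective (hc : IsTracelessAlternating K c)
    {a : Fin i → Fin n} (ha : ¬ Function.Injective a) (b : Fin i → Fin n) : c a b = 0 := by
  simp only [Function.Injective, not_forall] at ha
  obtain ⟨k, l, hkl, hne⟩ := ha
  have h := hc.alt_left (Equiv.swap k l) a b
  have h' : a ∘ Equiv.swap k l = a := by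
    rw [Equiv.comp_swap_eq_update, hkl, Function.update_eq_self, ← hkl, Function.update_eq_self]
  rw [h', Equiv.Perm.sign_swap hne] at h
  simp only [Units.val_neg, Units.val_one, neg_smul, one_smul] at h
  exact self_eq_neg.1 h

theorem IsTracelessAlternating.restrictDiag_sum (hc : IsTracelessAlternating K c) (q : ℕ) :
    restrictDiag K n (∑ a, ∑ b, C (c a b) * minorSum K q a b) =
      (i.factorial * q.factorial) • ∑ a : Fin i → Fin n,
        C (c a a) * ((∏ k, X (a k)) * partialEsymm K (Finset.univ.image a)ᶜ q) := by
  rw [map_sum, Finset.smul_sum]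
  refine Finset.sum_congr rfl fun a _ => ?_
  by_cases ha : Function.Injective a
  swap
  · simp [hc.eq_zero_of_not_injective ha]
  have hC : ∀ x : K, restrictDiag K n (C x) = C x := fun x => by
    rw [restrictDiag, aeval_C]
    rfl
  rw [map_sum]
  have hinj : Function.Injective fun σ : Equiv.Perm (Fin i) => a ∘ σ := fun σ τ h =>
    Equiv.ext fun k => ha (congrFun h k)
  -- For injective a only the i! rearrangements b of a contribute, all equally: the signs from the
  -- tensor and from the minor cancel.
  rw [← Finset.sum_subset (Finset.subset_univ (Finset.univ.image fun σ : Equiv.Perm (Fin i) =>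
    a ∘ σ)), Finset.sum_image hinj.injOn]
  · have h1 : ∀ σ : Equiv.Perm (Fin i),
        restrictDiag K n (C (c a (a ∘ σ)) * minorSum K q a (a ∘ σ)) =
          C (c a a) * restrictDiag K n (minorSum K q a a) := fun σ => by
      rw [map_mul, hC, restrictDiag_minorSum_comp_perm, hc.alt_right]
      rcases Int.units_eq_one_or (Equiv.Perm.sign σ) with h | h <;> simp [h]
    rw [Finset.sum_congr rfl fun σ _ => h1 σ, Finset.sum_const, Finset.card_univ,
      Fintype.card_perm, Fintype.card_fin, restrictDiag_minorSum_self q ha, mul_smul,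
      mul_smul_comm]
  · intro b _ hb
    rw [map_mul]
    suffices h : ∃ k, ∀ l, a k ≠ b l by
      obtain ⟨k, hk⟩ := h
      rw [restrictDiag_minorSum_eq_zero q k hk, mul_zero]
    by_contra! h
    choose τ hτ using h
    have hτi : Function.Injective τ := fun k l h => ha (by rw [hτ, hτ, h])
    refine hb (Finset.mem_image.2 ⟨(Equiv.ofBijective τ
      (Finite.injective_iff_bijective.1 hτi)).symm, Finset.mem_univ _, ?_⟩)
    funext l
    obtain ⟨k, rfl⟩ := (Finite.injective_iff_bijective.1 hτi).2 l
    simp only [Function.comp_apply]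
    rw [Equiv.ofBijective_symm_apply_apply, hτ]

omit [CharZero K] in
-- Summing over the entry a_k first produces a contraction of c in slot k.
theorem IsTracelessAlternating.sum_mul_eq_zero (hc : IsTracelessAlternating K c) (k : Fin i)
    {g : (Fin i → Fin n) → MvPolynomial (Fin n) K}
    (hg : ∀ a x, g (Function.update a k x) = g a) : ∑ a, C (c a a) * g a = 0 := by
  rw [← (Equiv.funSplitAt k (Fin n)).symm.sum_comp, Fintype.sum_prod_type_right]
  refine Finset.sum_eq_zero fun f _ => ?_
  rcases isEmpty_or_nonempty (Fin n) with h | ⟨⟨x₀⟩⟩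
  · simp
  have hup : ∀ x, (Equiv.funSplitAt k (Fin n)).symm (x, f) =
      Function.update ((Equiv.funSplitAt k (Fin n)).symm (x₀, f)) k x := fun x => by
    ext l
    by_cases hl : l = k
    · subst hl
      simp [Equiv.funSplitAt, Equiv.piSplitAt]
    · simp [Equiv.funSplitAt, Equiv.piSplitAt, hl]
  rw [Finset.sum_congr rfl fun x _ => by rw [hup x, hg], ← Finset.sum_mul, ← map_sum,
    hc.trace_zero, C_0, zero_mul]

/-- `e_(r - j)(S)`, understood as `0` if `j > r`. -/
def esymmSub (K : Type*) [Field K] (S : Finset (Fin n)) (r j : ℕ) : MvPolynomial (Fin n) K :=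
  if j ≤ r then partialEsymm K S (r - j) else 0

omit [CharZero K] in
theorem esymmSub_erase {S : Finset (Fin n)} {x : Fin n} (hx : x ∈ S) (r j : ℕ) :
    esymmSub K S r j = esymmSub K (S.erase x) r j + X x * esymmSub K (S.erase x) r (j + 1) := by
  rcases lt_trichotomy j r with h | rfl | h
  · rw [esymmSub, esymmSub, esymmSub, if_pos h.le, if_pos h.le, if_pos (by omega),
      show r - j = (r - (j + 1)) + 1 by omega, partialEsymm_erase hx]
  -- For j = r the last term has to be 0; truncated subtraction alone would make it x.
  · simp [esymmSub, partialEsymm_zero]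
  · rw [esymmSub, esymmSub, esymmSub, if_neg (by omega), if_neg (by omega), if_neg (by omega),
      mul_zero, add_zero]

/-- Sums that interpolate between two expressions of the polynomial given by `c`. -/
def mixedSum (c : (Fin i → Fin n) → (Fin i → Fin n) → K) (r : ℕ) (B : Finset (Fin i)) :
    MvPolynomial (Fin n) K :=
  ∑ a : Fin i → Fin n, C (c a a) *
    ((∏ k ∈ B, X (a k)) * esymmSub K (Finset.univ.image a)ᶜ r B.card)

/-- With A the image of a, the two summands combine by e_t(A^c) + a_k-variable · e_{t-1}(A^c) =
e_t(A^c ∪ {a_k}). The result no longer depends on a_k, so the sum vanishes by tracelessness. -/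
theorem IsTracelessAlternating.mixedSum_insert (hc : IsTracelessAlternating K c) (r : ℕ)
    {B : Finset (Fin i)} {k : Fin i} (hk : k ∉ B) :
    mixedSum c r (insert k B) = -mixedSum c r B := by
  rw [eq_neg_iff_add_eq_zero, ← hc.sum_mul_eq_zero k (g := fun a => (∏ l ∈ B, X (a l)) *
    esymmSub K ((Finset.univ.erase k).image a)ᶜ r B.card), mixedSum, mixedSum,
    ← Finset.sum_add_distrib]
  · refine Finset.sum_congr rfl fun a _ => ?_
    by_cases ha : Function.Injective a
    swap
    · simp [hc.eq_zero_of_not_injective ha]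
    have hmem : a k ∈ ((Finset.univ.erase k).image a)ᶜ := by
      simp only [Finset.mem_compl, Finset.mem_image, Finset.mem_erase, not_exists, not_and]
      exact fun l hl h => hl.1 (ha h)
    have hset : (((Finset.univ.erase k).image a)ᶜ).erase (a k) = (Finset.univ.image a)ᶜ := by
      rw [← Finset.compl_insert, ← Finset.image_insert, Finset.insert_erase (Finset.mem_univ k)]
    rw [esymmSub_erase hmem, hset, Finset.prod_insert hk, Finset.card_insert_of_notMem hk]
    ring
  · intro a x
    congr 1
    · refine Finset.prod_congr rfl fun l hl => ?_
      rw [Function.update_of_ne (ne_of_mem_of_not_mem hl hk)]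
    · congr 2
      refine Finset.image_congr fun l hl => ?_
      rw [Function.update_of_ne (Finset.ne_of_mem_erase hl)]

theorem IsTracelessAlternating.mixedSum_eq (hc : IsTracelessAlternating K c) (r : ℕ)
    (B : Finset (Fin i)) : mixedSum c r B = (-1) ^ B.card * mixedSum c r ∅ := by
  induction B using Finset.induction_on with
  | empty => simp
  | insert k B hk ih =>
    rw [hc.mixedSum_insert r hk, ih, Finset.card_insert_of_notMem hk]
    ring

omit [CharZero K] in
theorem mixedSum_empty (r : ℕ) : mixedSum c r ∅ =
    ∑ a : Fin i → Fin n, C (c a a) * partialEsymm K (Finset.univ.image a)ᶜ r := by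
  simp [mixedSum, esymmSub]

/-- The restriction is the mixed sum for B the set of all slots; passing to B = ∅ costs one sign per
slot and trades the monomial for a higher elementary symmetric polynomial. -/
theorem IsTracelessAlternating.restrictDiag_eq_mixedSum (hc : IsTracelessAlternating K c)
    (q : ℕ) : restrictDiag K n (∑ a, ∑ b, C (c a b) * minorSum K q a b) =
      (i.factorial * q.factorial) • ((-1) ^ i * mixedSum c (i + q) ∅) := by
  rw [hc.restrictDiag_sum]
  congr 1
  have h := hc.mixedSum_eq (i + q) Finset.univ
  rw [Finset.card_univ, Fintype.card_fin] at h
  rw [← h, mixedSum]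
  simp [esymmSub]

theorem IsTracelessAlternating.mixedSum_empty_eq_zero (hc : IsTracelessAlternating K c) {r : ℕ}
    (hr : r < i) : mixedSum c r ∅ = 0 := by
  have h := hc.mixedSum_eq r Finset.univ
  rw [Finset.card_univ, Fintype.card_fin] at h
  have h0 : mixedSum c r Finset.univ = 0 := by
    simp [mixedSum, esymmSub, hr]
  rw [h0] at h
  rcases neg_one_pow_eq_or (MvPolynomial (Fin n) K) i with h1 | h1 <;> rw [h1] at h <;>
    simpa using h.symm

theorem IsTracelessAlternating.mixedSum_mem_diagU (hc : IsTracelessAlternating K c) (r : ℕ) :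
    mixedSum c r ∅ ∈ diagU K n i r := by
  rcases lt_or_ge r i with hr | hr
  · rw [hc.mixedSum_empty_eq_zero hr]
    exact zero_mem _
  · obtain ⟨q, rfl⟩ := Nat.exists_eq_add_of_le hr
    have h := hc.restrictDiag_eq_mixedSum q
    have h1 : restrictDiag K n (∑ a, ∑ b, C (c a b) * minorSum K q a b) ∈ diagU K n i (i + q) :=
      ⟨_, Submodule.subset_span ⟨q, c, rfl, hc, rfl⟩, rfl⟩
    rw [h, ← Nat.cast_smul_eq_nsmul K, Submodule.smul_mem_iff _
      (by exact_mod_cast (Nat.mul_pos i.factorial_pos q.factorial_pos).ne')] at h1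
    rcases neg_one_pow_eq_or (MvPolynomial (Fin n) K) i with h2 | h2 <;> rw [h2] at h1
    · rwa [one_mul] at h1
    · rwa [neg_one_mul, neg_mem_iff] at h1

theorem diagU_le_span_esymmSet (n i p : ℕ) :
    diagU K n i p ≤ Submodule.span K (esymmSet K n p (n - i)) := by
  rw [diagU, weymanU, Submodule.map_span, Submodule.span_le]
  rintro _ ⟨_, ⟨q, c, rfl, hc, rfl⟩, rfl⟩
  rw [AlgHom.toLinearMap_apply, hc.restrictDiag_eq_mixedSum, mixedSum_empty]
  refine Submodule.smul_of_tower_mem _ _ ?_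
  suffices h : ∑ a : Fin i → Fin n, C (c a a) * partialEsymm K (Finset.univ.image a)ᶜ (i + q) ∈
      Submodule.span K (esymmSet K n (i + q) (n - i)) by
    rcases neg_one_pow_eq_or (MvPolynomial (Fin n) K) i with h2 | h2 <;> rw [h2]
    · rwa [one_mul]
    · rwa [neg_one_mul, neg_mem_iff]
  refine Submodule.sum_mem _ fun a _ => ?_
  by_cases ha : Function.Injective a
  · rw [← smul_eq_C_mul]
    refine Submodule.smul_mem _ _ (Submodule.subset_span ⟨_, ?_, rfl⟩)
    rw [Finset.card_compl, Finset.card_image_of_injective _ ha, Finset.card_univ,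
      Fintype.card_fin, Fintype.card_fin]
  · rw [hc.eq_zero_of_not_injective ha, C_0, zero_mul]
    exact zero_mem _

end TracelessTensors

/-! ### Splitting e_r(n - i) into e_r(n - i + 1) and Weyman's part. -/

section Decomposition

variable {K : Type*} [Field K] {n i : ℕ}

/-- The alternating tensor with diagonal entries `v A`, `A` a set of size `i`. -/
def tensorOfSets (i : ℕ) (v : Finset (Fin n) → K) (a b : Fin i → Fin n) : K :=
  v (Finset.univ.image a) * (Matrix.of fun k l => if a k = b l then (1 : K) else 0).det

theorem tensorOfSets_self_of_injective (v : Finset (Fin n) → K) {a : Fin i → Fin n}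
    (ha : Function.Injective a) : tensorOfSets i v a a = v (Finset.univ.image a) := by
  have : (Matrix.of fun k l => if a k = a l then (1 : K) else 0) = 1 := by
    ext k l
    simp [Matrix.one_apply, ha.eq_iff]
  rw [tensorOfSets, this, Matrix.det_one, mul_one]

theorem isTracelessAlternating_tensorOfSets {v : Finset (Fin n) → K}
    (hv : ∀ B : Finset (Fin n), B.card + 1 = i → ∑ x ∈ Bᶜ, v (insert x B) = 0) :
    IsTracelessAlternating K (tensorOfSets i v) where
  alt_left σ a b := by
    have h1 : Finset.univ.image (a ∘ σ) = Finset.univ.image a := by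
      rw [← Finset.image_image, Finset.image_univ_equiv]
    have h2 := Matrix.det_permute σ (Matrix.of fun k l => if a k = b l then (1 : K) else 0)
    rw [tensorOfSets, tensorOfSets, h1, zsmul_eq_mul, mul_left_comm]
    rw [← h2]
    rfl
  alt_right σ a b := by
    have h2 := Matrix.det_permute' σ (Matrix.of fun k l => if a k = b l then (1 : K) else 0)
    rw [tensorOfSets, tensorOfSets, zsmul_eq_mul, mul_left_comm]
    rw [← h2]
    rfl
  trace_zero s a b := by
    have hmat : ∀ x, (∀ k, k ≠ s → a k ≠ x) → (∀ k, k ≠ s → b k ≠ x) →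
        (Matrix.of fun k l => if Function.update a s x k = Function.update b s x l
          then (1 : K) else 0) =
        Matrix.of fun k l => if k = s ∨ l = s then (if k = s ∧ l = s then 1 else 0) else
          if a k = b l then (1 : K) else 0 := by
      intro x hxa hxb
      ext k l
      by_cases hk : k = s <;> by_cases hl : l = s
      · simp [hk, hl]
      · simp [hk, hl, (hxb l hl).symm]
      · simp [hk, hl, hxa k hk]
      · simp [hk, hl]
    have hzero_a : ∀ x, (∃ k, k ≠ s ∧ a k = x) →
        tensorOfSets i v (Function.update a s x) (Function.update b s x) = 0 := by
      rintro x ⟨k, hk, rfl⟩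
      rw [tensorOfSets, Matrix.det_zero_of_row_eq hk, mul_zero]
      ext l
      simp [hk]
    have hzero_b : ∀ x, (∃ k, k ≠ s ∧ b k = x) →
        tensorOfSets i v (Function.update a s x) (Function.update b s x) = 0 := by
      rintro x ⟨k, hk, rfl⟩
      rw [tensorOfSets, Matrix.det_zero_of_column_eq hk, mul_zero]
      intro l
      simp [hk]
    -- If x avoids the other entries of a and b, the matrix splits off a 1 at (s, s); its
    -- determinant D does not depend on x.
    set D : K := (Matrix.of fun k l => if k = s ∨ l = s then (if k = s ∧ l = s then 1 else 0) else
          if a k = b l then (1 : K) else 0).det with hD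
    set B := (Finset.univ.erase s).image a with hB
    have himage : ∀ x, Finset.univ.image (Function.update a s x) = insert x B := by
      intro x
      rw [← Finset.insert_erase (Finset.mem_univ s), Finset.image_insert, Function.update_self]
      congr 1
      refine Finset.image_congr fun l hl => ?_
      rw [Function.update_of_ne (Finset.ne_of_mem_erase hl)]
    have hmemB : ∀ x, x ∈ B ↔ ∃ k, k ≠ s ∧ a k = x := fun x => by simp [hB]
    by_cases hba : ∀ k, k ≠ s → b k ∈ B
    · by_cases hinj : ∀ k l, k ≠ s → l ≠ s → a k = a l → k = l
      · have hcard : B.card + 1 = i := by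
          have hs := Finset.card_erase_add_one (Finset.mem_univ s)
          rw [Finset.card_univ, Fintype.card_fin] at hs
          rwa [hB, Finset.card_image_of_injOn fun k hk l hl h =>
            hinj k l (Finset.ne_of_mem_erase hk) (Finset.ne_of_mem_erase hl) h]
        rw [← Finset.sum_subset (Finset.subset_univ Bᶜ)]
        · rw [← zero_mul D, ← hv B hcard, Finset.sum_mul]
          refine Finset.sum_congr rfl fun x hx => ?_
          have hxB := Finset.mem_compl.1 hx
          rw [tensorOfSets, himage, hmat x fun k hk h => hxB ((hmemB x).2 ⟨k, hk, h⟩)]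
          exact fun k hk h => hxB (h ▸ hba k hk)
        · intro x _ hx
          exact hzero_a x ((hmemB x).1 (by simpa using hx))
      · push Not at hinj
        obtain ⟨k, l, hk, hl, hkl, hne⟩ := hinj
        refine Finset.sum_eq_zero fun x _ => ?_
        rw [tensorOfSets, Matrix.det_zero_of_row_eq hne, mul_zero]
        ext j
        simp [hk, hl, hkl]
    · push Not at hba
      obtain ⟨k, hk, hkB⟩ := hba
      refine Finset.sum_eq_zero fun x _ => ?_
      by_cases hx : x = b k
      · exact hzero_b x ⟨k, hk, hx.symm⟩
      · rw [tensorOfSets, Matrix.det_eq_zero_of_column_eq_zero k, mul_zero]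
        intro l
        by_cases hl : l = s
        · simp [hl, hk, hx]
        · simp only [Matrix.of_apply, Function.update_of_ne hl, Function.update_of_ne hk]
          exact if_neg fun h => hkB ((hmemB _).2 ⟨l, hl, h⟩)

variable [CharZero K]

theorem mixedSum_tensorOfSets {v : Finset (Fin n) → K}
    (hv : ∀ B : Finset (Fin n), B.card + 1 = i → ∑ x ∈ Bᶜ, v (insert x B) = 0) (r : ℕ) :
    mixedSum (tensorOfSets i v) r ∅ = i.factorial •
      ∑ A ∈ Finset.univ.powersetCard i, C (v A) * partialEsymm K Aᶜ r := by
  rw [mixedSum_empty, ← sum_injective_image i Finset.univ fun A => C (v A) * partialEsymm K Aᶜ r,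
    ← Finset.sum_subset (Finset.filter_subset (fun a : Fin i → Fin n =>
      Function.Injective a ∧ ∀ k, a k ∈ Finset.univ) _)]
  · refine Finset.sum_congr rfl fun a ha => ?_
    rw [tensorOfSets_self_of_injective v (Finset.mem_filter.1 ha).2.1]
  · intro a _ ha
    rw [(isTracelessAlternating_tensorOfSets hv).eq_zero_of_not_injective, C_0, zero_mul]
    simpa using ha

theorem sum_sets_mem_diagU {v : Finset (Fin n) → K}
    (hv : ∀ B : Finset (Fin n), B.card + 1 = i → ∑ x ∈ Bᶜ, v (insert x B) = 0) (r : ℕ) :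
    ∑ A ∈ Finset.univ.powersetCard i, C (v A) * partialEsymm K Aᶜ r ∈ diagU K n i r := by
  have h := (isTracelessAlternating_tensorOfSets hv).mixedSum_mem_diagU r
  rwa [mixedSum_tensorOfSets hv, ← Nat.cast_smul_eq_nsmul K, Submodule.smul_mem_iff _
      (by exact_mod_cast i.factorial_pos.ne')] at h

omit [CharZero K] in
open Matrix in
-- Over ℚ the matrices M Mᵀ and M have the same rank, hence the same range. Positivity is used here,
-- so the decomposition is found over ℚ and then mapped to K.
theorem exists_mulVec_sub_eq_zero {ι κ : Type*} [Fintype ι] [Fintype κ] [DecidableEq ι]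
    (M : Matrix ι κ ℚ) (x : κ → ℚ) : ∃ w : ι → ℚ, M *ᵥ (x - Mᵀ *ᵥ w) = 0 := by
  have hle : LinearMap.range (M * Mᵀ).mulVecLin ≤ LinearMap.range M.mulVecLin := by
    classical
    rw [Matrix.mulVecLin_mul]
    exact LinearMap.range_comp_le_range _ _
  have heq := Submodule.eq_of_le_of_finrank_eq hle (Matrix.rank_self_mul_transpose M)
  obtain ⟨w, hw⟩ : M *ᵥ x ∈ LinearMap.range (M * Mᵀ).mulVecLin := heq ▸ ⟨x, rfl⟩
  refine ⟨w, ?_⟩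
  rw [Matrix.mulVec_sub, Matrix.mulVec_mulVec, ← hw]
  exact sub_self _

/-- The indicator function of a set of size `i` is the sum of a function that is killed by the
down operator and of one in the image of the up operator. -/
theorem exists_traceless_add_up (i : ℕ) (A : Finset (Fin n)) :
    ∃ v w : Finset (Fin n) → K,
      (∀ B : Finset (Fin n), B.card + 1 = i → ∑ x ∈ Bᶜ, v (insert x B) = 0) ∧
      ∀ A' : Finset (Fin n), A'.card = i →
        (if A' = A then 1 else 0) = v A' + ∑ x ∈ A', w (A'.erase x) := by
  -- The down operator from i-subsets to (i - 1)-subsets, extended by zero to all sets; its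
  -- transpose is the up operator.
  let M : Matrix (Finset (Fin n)) (Finset (Fin n)) ℚ :=
    Matrix.of fun B A' => if B.card + 1 = i ∧ ∃ x ∈ Bᶜ, insert x B = A' then 1 else 0
  obtain ⟨w, hw⟩ := exists_mulVec_sub_eq_zero M (Pi.single A 1)
  have hM : ∀ B : Finset (Fin n), B.card + 1 = i → ∀ u : Finset (Fin n) → ℚ,
      M.mulVec u B = ∑ x ∈ Bᶜ, u (insert x B) := by
    intro B hB u
    have hinj : Set.InjOn (fun x => insert x B) (Bᶜ : Finset (Fin n)) := fun x hx y _ h =>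
      (Finset.insert_inj (by simpa using hx)).1 h
    rw [Matrix.mulVec, dotProduct, ← Finset.sum_image hinj (f := u),
      ← Finset.sum_subset (Finset.subset_univ (Bᶜ.image fun x => insert x B))]
    · refine Finset.sum_congr rfl fun A' hA' => ?_
      obtain ⟨x, hx, hx'⟩ := Finset.mem_image.1 hA'
      simp only [M, Matrix.of_apply]
      rw [if_pos ⟨hB, x, hx, hx'⟩, one_mul]
    · intro A' _ hA'
      simp only [M, Matrix.of_apply]
      rw [if_neg, zero_mul]
      rintro ⟨-, x, hx, hx'⟩
      exact hA' (Finset.mem_image.2 ⟨x, hx, hx'⟩)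
  have hMt : ∀ A' : Finset (Fin n), A'.card = i →
      M.transpose.mulVec w A' = ∑ x ∈ A', w (A'.erase x) := by
    intro A' hA'
    have hinj : Set.InjOn (fun x => A'.erase x) A' := fun x hx y hy h =>
      (Finset.erase_inj A' hx).1 h
    rw [Matrix.mulVec, dotProduct, ← Finset.sum_image hinj (f := w),
      ← Finset.sum_subset (Finset.subset_univ (A'.image fun x => A'.erase x))]
    · refine Finset.sum_congr rfl fun B hB => ?_
      obtain ⟨x, hx, rfl⟩ := Finset.mem_image.1 hB
      simp only [M, Matrix.transpose_apply, Matrix.of_apply]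
      rw [if_pos ⟨by rw [Finset.card_erase_add_one hx, hA'], x, by simp,
        Finset.insert_erase hx⟩, one_mul]
    · intro B _ hB
      simp only [M, Matrix.transpose_apply, Matrix.of_apply]
      rw [if_neg, zero_mul]
      rintro ⟨-, x, hx, rfl⟩
      exact hB (Finset.mem_image.2 ⟨x, Finset.mem_insert_self x B,
        Finset.erase_insert (Finset.mem_compl.1 hx)⟩)
  refine ⟨fun A' => (((Pi.single A 1 - M.transpose.mulVec w : Finset (Fin n) → ℚ) A' : ℚ) : K),
    fun B => (w B : K), fun B hB => ?_, fun A' hA' => ?_⟩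
  · rw [← Rat.cast_sum, ← hM B hB, hw]
    simp
  · rw [← Rat.cast_sum, ← hMt A' hA', ← Rat.cast_add, Pi.sub_apply, sub_add_cancel,
      Pi.single_apply]
    split_ifs <;> simp

/-- Regroup by B = A - x: the inner sum of e_r(B^c - x) over x is a scalar multiple of e_r(B^c). -/
theorem sum_up_mem_span (w : Finset (Fin n) → K) (hi : 1 ≤ i) (r : ℕ) :
    ∑ A ∈ Finset.univ.powersetCard i, C (∑ x ∈ A, w (A.erase x)) * partialEsymm K Aᶜ r ∈
      Submodule.span K (esymmSet K n r (n - i + 1)) := by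
  have h : ∑ A ∈ Finset.univ.powersetCard i, C (∑ x ∈ A, w (A.erase x)) * partialEsymm K Aᶜ r =
      ∑ B ∈ Finset.univ.powersetCard (i - 1), ∑ x ∈ Bᶜ,
        C (w B) * partialEsymm K (Bᶜ.erase x) r := by
    simp only [map_sum, Finset.sum_mul]
    rw [Finset.sum_sigma', Finset.sum_sigma']
    refine Finset.sum_bij' (fun p _ => ⟨p.1.erase p.2, p.2⟩) (fun p _ => ⟨insert p.2 p.1, p.2⟩)
      ?_ ?_ ?_ ?_ ?_
    · rintro ⟨A, x⟩ hp
      simp only [Finset.mem_sigma, Finset.mem_powersetCard_univ, Finset.mem_compl] at hp ⊢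
      exact ⟨by rw [Finset.card_erase_of_mem hp.2, hp.1], Finset.notMem_erase x A⟩
    · rintro ⟨B, x⟩ hp
      simp only [Finset.mem_sigma, Finset.mem_powersetCard_univ, Finset.mem_compl] at hp ⊢
      exact ⟨by rw [Finset.card_insert_of_notMem hp.2, hp.1]; omega, Finset.mem_insert_self x B⟩
    · rintro ⟨A, x⟩ hp
      simp only [Finset.mem_sigma] at hp
      simp [Finset.insert_erase hp.2]
    · rintro ⟨B, x⟩ hp
      simp only [Finset.mem_sigma, Finset.mem_compl] at hp
      simp [Finset.erase_insert hp.2]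
    · rintro ⟨A, x⟩ hp
      simp only [Finset.mem_sigma] at hp
      rw [← Finset.compl_insert, Finset.insert_erase hp.2]
  rw [h]
  refine Submodule.sum_mem _ fun B hB => ?_
  have hB' := Finset.mem_powersetCard_univ.1 hB
  rw [← Finset.mul_sum, sum_partialEsymm_erase, ← mul_assoc,
    ← map_natCast (C : K →+* MvPolynomial (Fin n) K),
    ← map_natCast (C : K →+* MvPolynomial (Fin n) K), ← C_sub, ← C_mul, ← smul_eq_C_mul]
  have hle := Finset.card_le_univ B
  rw [Fintype.card_fin] at hle
  by_cases hin : i ≤ n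
  · refine Submodule.smul_mem _ _ (Submodule.subset_span ⟨Bᶜ, ?_, rfl⟩)
    rw [Finset.card_compl, hB', Fintype.card_fin]
    omega
  · have : Bᶜ.card = 0 := by
      rw [Finset.card_compl, hB', Fintype.card_fin]
      omega
    rw [this]
    rcases Nat.eq_zero_or_pos r with rfl | hr
    · simp
    · rw [partialEsymm_eq_zero (by omega), smul_zero]
      exact zero_mem _

theorem esymmSet_subset_span_sup_diagU (hi : 1 ≤ i) (hin : i ≤ n) (r : ℕ) :
    esymmSet K n r (n - i) ⊆
      (Submodule.span K (esymmSet K n r (n - i + 1)) ⊔ diagU K n i r :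
        Submodule K (MvPolynomial (Fin n) K)) := by
  rintro _ ⟨S, hS, rfl⟩
  have hSc : Sᶜ.card = i := by
    rw [Finset.card_compl, hS, Fintype.card_fin]
    omega
  obtain ⟨v, w, hv, hvw⟩ := exists_traceless_add_up (K := K) i Sᶜ
  have h : partialEsymm K S r =
      ∑ A ∈ Finset.univ.powersetCard i, C (∑ x ∈ A, w (A.erase x)) * partialEsymm K Aᶜ r +
        ∑ A ∈ Finset.univ.powersetCard i, C (v A) * partialEsymm K Aᶜ r := by
    rw [← Finset.sum_add_distrib, Finset.sum_eq_single Sᶜ]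
    · rw [← add_mul, ← C_add, add_comm, ← hvw _ hSc, if_pos rfl, C_1, one_mul, compl_compl]
    · intro A hA hne
      rw [← add_mul, ← C_add, add_comm, ← hvw A (Finset.mem_powersetCard_univ.1 hA), if_neg hne,
        C_0, zero_mul]
    · intro h
      exact absurd (Finset.mem_powersetCard_univ.2 hSc) h
  rw [h]
  exact Submodule.add_mem_sup (sum_up_mem_span w hi r) (sum_sets_mem_diagU hv r)

end Decomposition

/-! ### Nonvanishing of `diagU`. -/

section Nonvanishing

variable {K : Type*} [Field K] {n : ℕ}

theorem eval_indicator_partialEsymm (S Z : Finset (Fin n)) (r : ℕ) :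
    eval (fun x => if x ∈ Z then (1 : K) else 0) (partialEsymm K S r) =
      ((S ∩ Z).card.choose r : K) := by
  have h : (S.powersetCard r).filter (fun T => ∀ x ∈ T, x ∈ Z) = (S ∩ Z).powersetCard r := by
    ext T
    simp only [Finset.mem_filter, Finset.mem_powersetCard, Finset.subset_inter_iff]
    exact ⟨fun ⟨⟨h1, h2⟩, h3⟩ => ⟨⟨h1, h3⟩, h2⟩, fun ⟨⟨h1, h3⟩, h2⟩ => ⟨⟨h1, h2⟩, h3⟩⟩
  simp only [partialEsymm, map_sum, map_prod, eval_X, Finset.prod_ite_zero, Finset.prod_const_one]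
  rw [Finset.sum_boole, h, Finset.card_powersetCard]

theorem card_inter_image_perm {S : Finset (Fin n)} {τ : Equiv.Perm (Fin n)}
    (hτ : ∀ x, τ x ∈ S ↔ x ∈ S) (Z : Finset (Fin n)) : (S ∩ Z.map τ.toEmbedding).card =
      (S ∩ Z).card := by
  rw [← Finset.card_map τ.toEmbedding (s := S ∩ Z), Finset.map_inter]
  congr 2
  ext x
  have h := hτ (τ.symm x)
  rw [Equiv.apply_symm_apply] at h
  rw [Finset.mem_map_equiv, h]

/-- The set that contains exactly one element of each pair `k, k + i`, `k < i`, as prescribed by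
`ε`, and the elements `2 i, …, i + p - 1`. -/
def choiceSet (n i p : ℕ) (ε : Finset ℕ) : Finset (Fin n) :=
  Finset.univ.filter fun x => (x.1 < i ∧ x.1 ∈ ε) ∨ (i ≤ x.1 ∧ x.1 < 2 * i ∧ x.1 - i ∉ ε) ∨
    (2 * i ≤ x.1 ∧ x.1 < i + p)

theorem choiceSet_insert {i p k : ℕ} {ε : Finset ℕ} (hk : k < i) (hkε : k ∉ ε)
    (hn : k + i < n) : choiceSet n i p (insert k ε) = (choiceSet n i p ε).map
      (Equiv.swap (⟨k, by omega⟩ : Fin n) ⟨k + i, hn⟩).toEmbedding := by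
  ext x
  rw [Finset.mem_map_equiv, Equiv.symm_swap]
  by_cases hx : x = ⟨k, by omega⟩
  · subst hx
    rw [Equiv.swap_apply_left]
    simp [choiceSet, hk, hkε]
    omega
  by_cases hx' : x = ⟨k + i, hn⟩
  · subst hx'
    rw [Equiv.swap_apply_right]
    simp [choiceSet, hk, hkε]
    omega
  rw [Equiv.swap_apply_of_ne_of_ne hx hx']
  rw [Fin.ext_iff] at hx hx'
  simp only at hx hx'
  have h1 : x.1 ∈ insert k ε ↔ x.1 ∈ ε := by simp [hx]
  simp only [choiceSet, Finset.mem_filter, Finset.mem_univ, true_and, h1]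
  by_cases h2 : i ≤ x.1
  · have h3 : x.1 - i ∈ insert k ε ↔ x.1 - i ∈ ε := by
      rw [Finset.mem_insert, or_iff_right (by omega)]
    rw [h3]
  · simp [h2]

/-- The alternating sum of the values at the indicator vectors of the sets `choiceSet n i p ε`. -/
def altEval (K : Type*) [Field K] (n i p : ℕ) : MvPolynomial (Fin n) K →ₗ[K] K :=
  ∑ ε ∈ (Finset.range i).powerset, (-1 : K) ^ ε.card •
    (aeval fun x => if x ∈ choiceSet n i p ε then (1 : K) else 0).toLinearMap

theorem altEval_partialEsymm (i p : ℕ) (S : Finset (Fin n)) :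
    altEval K n i p (partialEsymm K S p) = ∑ ε ∈ (Finset.range i).powerset,
      (-1 : K) ^ ε.card * ((S ∩ choiceSet n i p ε).card.choose p : K) := by
  rw [altEval, LinearMap.sum_apply]
  refine Finset.sum_congr rfl fun ε _ => ?_
  rw [LinearMap.smul_apply, smul_eq_mul, ← eval_indicator_partialEsymm, ← coe_aeval_eq_eval]
  rfl

/-- The complement of S has only i - 1 elements, so S contains both members of some pair k, k + i.
Exchanging them matches ε with ε ∪ {k}: equal values, opposite signs. -/
theorem altEval_eq_zero {i p : ℕ} (hi : 1 ≤ i) (hin : 2 * i ≤ n) {S : Finset (Fin n)}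
    (hS : S.card = n - i + 1) : altEval K n i p (partialEsymm K S p) = 0 := by
  have hSc : Sᶜ.card < (Finset.range i).card := by
    rw [Finset.card_compl, hS, Fintype.card_fin, Finset.card_range]
    omega
  obtain ⟨k, hk, hkS⟩ := Finset.exists_mem_notMem_of_card_lt_card
    (lt_of_le_of_lt (Finset.card_image_le (s := Sᶜ) (f := fun x => x.1 % i)) hSc)
  rw [Finset.mem_range] at hk
  have hmem : ∀ x : Fin n, x.1 % i = k → x ∈ S := fun x hx => by
    by_contra h
    exact hkS (Finset.mem_image.2 ⟨x, Finset.mem_compl.2 h, hx⟩)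
  have hn : k + i < n := by omega
  have h1 : (⟨k, by omega⟩ : Fin n) ∈ S := hmem _ (Nat.mod_eq_of_lt hk)
  have h2 : (⟨k + i, hn⟩ : Fin n) ∈ S := hmem _ (by simp [Nat.mod_eq_of_lt hk])
  rw [altEval_partialEsymm, ← Finset.insert_erase (Finset.mem_range.2 hk),
    Finset.sum_powerset_insert (Finset.notMem_erase _ _), ← Finset.sum_add_distrib]
  refine Finset.sum_eq_zero fun ε hε => ?_
  have hkε : k ∉ ε := fun h => Finset.notMem_erase _ _ (Finset.mem_powerset.1 hε h)
  rw [choiceSet_insert hk hkε hn, card_inter_image_perm, Finset.card_insert_of_notMem hkε]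
  · ring
  · intro x
    by_cases hx : x = ⟨k, by omega⟩
    · rw [hx, Equiv.swap_apply_left]
      exact iff_of_true h2 h1
    by_cases hx' : x = ⟨k + i, hn⟩
    · rw [hx', Equiv.swap_apply_right]
      exact iff_of_true h1 h2
    rw [Equiv.swap_apply_of_ne_of_ne hx hx']

theorem altEval_eq_one {i p : ℕ} (hip : i ≤ p) (hpn : i + p ≤ n) :
    altEval K n i p (partialEsymm K (Finset.univ.filter fun x : Fin n => i ≤ x.1) p) = 1 := by
  set I : Finset (Fin n) := Finset.univ.filter fun x => i ≤ x.1 ∧ x.1 < i + p with hI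
  have hIc : I.card = p := by
    rw [← Finset.card_image_of_injective I Fin.val_injective]
    have : I.image Fin.val = Finset.Ico i (i + p) := by
      ext y
      simp only [hI, Finset.mem_image, Finset.mem_filter, Finset.mem_univ, true_and,
        Finset.mem_Ico]
      exact ⟨by rintro ⟨x, hx, rfl⟩; exact hx, fun hy => ⟨⟨y, by omega⟩, hy, rfl⟩⟩
    rw [this, Nat.card_Ico, Nat.add_sub_cancel_left]
  have hset : ∀ ε, (Finset.univ.filter fun x : Fin n => i ≤ x.1) ∩ choiceSet n i p ε =
      I.filter fun x => 2 * i ≤ x.1 ∨ x.1 - i ∉ ε := by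
    intro ε
    ext x
    simp only [hI, choiceSet, Finset.mem_inter, Finset.mem_filter, Finset.mem_univ, true_and]
    by_cases h : x.1 - i ∈ ε <;> by_cases h' : x.1 ∈ ε <;>
      simp only [h, h', not_true_eq_false, not_false_eq_true, and_true, and_false, or_true,
        or_false, false_or] <;> omega
  rw [altEval_partialEsymm, Finset.sum_eq_single ∅]
  · rw [hset, Finset.filter_true_of_mem (by simp), hIc]
    simp
  · intro ε hε hne
    obtain ⟨k, hk⟩ := Finset.nonempty_iff_ne_empty.2 hne
    have hki := Finset.mem_range.1 (Finset.mem_powerset.1 hε hk)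
    -- Each k ∈ ε removes k + i from the intersection, leaving fewer than p elements; only ε = ∅
    -- survives.
    rw [hset, Nat.choose_eq_zero_of_lt, Nat.cast_zero, mul_zero]
    refine lt_of_lt_of_eq (Finset.card_lt_card (Finset.filter_ssubset.2
      ⟨⟨k + i, by omega⟩, ?_, ?_⟩)) hIc
    · simp only [hI, Finset.mem_filter, Finset.mem_univ, true_and]
      omega
    · simp only [Nat.add_sub_cancel]
      rintro (h | h)
      · omega
      · exact h hk
  · intro h
    exact absurd (Finset.empty_mem_powerset _) h

/-- If `diagU` were 0, e_p(n - i) would lie in the span of e_p(n - i + 1), which `altEval` kills;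
but it takes the value 1 on a member of e_p(n - i). -/
theorem diagU_ne_bot [CharZero K] {i p : ℕ} (hi : 1 ≤ i) (hip : i ≤ p) (hpn : i + p ≤ n) :
    diagU K n i p ≠ ⊥ := by
  intro hbot
  have hcard : (Finset.univ.filter fun x : Fin n => i ≤ x.1).card = n - i := by
    rw [← Finset.card_image_of_injective _ Fin.val_injective]
    have : (Finset.univ.filter fun x : Fin n => i ≤ x.1).image Fin.val = Finset.Ico i n := by
      ext y
      simp only [Finset.mem_image, Finset.mem_filter, Finset.mem_univ, true_and, Finset.mem_Ico]
      exact ⟨by rintro ⟨x, hx, rfl⟩; exact ⟨hx, x.2⟩, fun hy => ⟨⟨y, hy.2⟩, hy.1, rfl⟩⟩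
    rw [this, Nat.card_Ico]
  have h := esymmSet_subset_span_sup_diagU (K := K) hi (show i ≤ n by omega) p ⟨_, hcard, rfl⟩
  rw [hbot, sup_bot_eq, SetLike.mem_coe] at h
  have hle : Submodule.span K (esymmSet K n p (n - i + 1)) ≤ LinearMap.ker (altEval K n i p) := by
    refine Submodule.span_le.2 ?_
    rintro _ ⟨S, hS, rfl⟩
    exact altEval_eq_zero hi (by omega) hS
  have h0 := LinearMap.mem_ker.1 (hle h)
  rw [altEval_eq_one hip hpn] at h0
  exact one_ne_zero h0

end Nonvanishing

/-! ### Ideals generated by Weyman's generators. -/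

section WeymanGenerators

variable {K : Type*} [Field K] [CharZero K]

theorem isHomogeneous_of_mem_diagU {n i p : ℕ} {f : MvPolynomial (Fin n) K}
    (hf : f ∈ diagU K n i p) : f.IsHomogeneous p := by
  have hle : Submodule.span K (esymmSet K n p (n - i)) ≤ homogeneousSubmodule (Fin n) K p := by
    refine Submodule.span_le.2 ?_
    rintro _ ⟨S, -, rfl⟩
    exact partialEsymm_isHomogeneous S p
  exact hle (diagU_le_span_esymmSet n i p hf)

theorem esymmSet_subset_diagU_zero (n r : ℕ) : esymmSet K n r n ⊆ diagU K n 0 r := by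
  rintro _ ⟨S, hS, rfl⟩
  have hS' : S = Finset.univ := Finset.card_eq_iff_eq_univ S |>.1 (by simpa using hS)
  -- For i = 0 the trace condition is vacuous, so the constant 1 is admissible.
  have h := sum_sets_mem_diagU (K := K) (i := 0) (n := n) (v := fun _ => 1)
    (fun B hB => absurd hB (by omega)) r
  simpa [hS'] using h

theorem diagU_subset_of_esymmSet_subset {n i p : ℕ} {J : Ideal (MvPolynomial (Fin n) K)}
    (h : esymmSet K n p (n - i) ⊆ J) :
    (diagU K n i p : Set (MvPolynomial (Fin n) K)) ⊆ J :=
  (diagU_le_span_esymmSet n i p).trans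
    (Submodule.span_le.2 h : _ ≤ Submodule.restrictScalars K J)

theorem esymmSet_subset_of_diagU_subset {n i r : ℕ} (hi : 1 ≤ i) (hin : i ≤ n)
    {J : Ideal (MvPolynomial (Fin n) K)} (h : esymmSet K n r (n - i + 1) ⊆ J)
    (hU : (diagU K n i r : Set (MvPolynomial (Fin n) K)) ⊆ J) :
    esymmSet K n r (n - i) ⊆ J :=
  (esymmSet_subset_span_sup_diagU hi hin r).trans
    (sup_le (Submodule.span_le.2 h) hU : _ ≤ Submodule.restrictScalars K J)

variable {μ : YoungDiagram}

/-- Since b_{i-1} ≤ b_i, column i - 1 yields e_{b_i}(n - i + 1), and `diagU` supplies the rest of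
column i. The alternative in `h` serves columns whose generators were deleted but are known to lie
in J. -/
theorem esymmSet_topEntry_subset {J : Ideal (MvPolynomial (Fin μ.card) K)} {N : ℕ}
    (hN : N ≤ μ.rowLen 0)
    (h0 : ∀ p, 1 ≤ p → p ≤ μ.colLen 0 →
      (diagU K μ.card 0 p : Set (MvPolynomial (Fin μ.card) K)) ⊆ J)
    (h : ∀ i, 1 ≤ i → i < N →
      (diagU K μ.card i (topEntry μ i) : Set (MvPolynomial (Fin μ.card) K)) ⊆ J ∨
        esymmSet K μ.card (topEntry μ i) (μ.card - i) ⊆ J) {i : ℕ} (hi : 1 ≤ i) (hiN : i < N) :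
    esymmSet K μ.card (topEntry μ i) (μ.card - i) ⊆ J := by
  have hc := rowLen_zero_le_card μ
  induction i, hi using Nat.le_induction with
  | base =>
    refine (h 1 le_rfl hiN).elim (esymmSet_subset_of_diagU_subset le_rfl (by omega) ?_) id
    rw [topEntry_one, Nat.sub_add_cancel (by omega)]
    exact (esymmSet_subset_diagU_zero _ _).trans
      (h0 _ (colLen_pos_iff.2 (by omega)) le_rfl)
  | succ i hi ih =>
    refine (h _ (by omega) hiN).elim (esymmSet_subset_of_diagU_subset (by omega) (by omega) ?_) id
    rw [show μ.card - (i + 1) + 1 = μ.card - i by omega]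
    exact esymmSet_mono_degree (by omega) (topEntry_mono (Nat.le_succ i) (by omega))
      (ih (by omega))

variable {B : ℕ × ℕ → Set (MvPolynomial (Fin μ.card) K)}

omit [CharZero K] in
theorem diagU_subset_span_genSet
    (hB : ∀ i p, IsBasisSet K (B (i, p)) (diagU K μ.card i p)) {L : Set (ℕ × ℕ)} {i p : ℕ}
    (h : (i, p) ∈ L) : (diagU K μ.card i p : Set (MvPolynomial (Fin μ.card) K)) ⊆
      (Ideal.span (genSet L B) : Set (MvPolynomial (Fin μ.card) K)) := by
  rw [← (hB i p).2]
  refine (Submodule.span_le.2 fun f hf => ?_ :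
    _ ≤ Submodule.restrictScalars K (Ideal.span (genSet L B)))
  exact Ideal.subset_span (Set.mem_biUnion h hf)

theorem span_genSet_weymanLabels_le (hμ : 2 ≤ μ.rowLen 0)
    (hB : ∀ i p, IsBasisSet K (B (i, p)) (diagU K μ.card i p)) :
    Ideal.span (genSet (weymanLabels μ) B) ≤ dpIdeal K μ := by
  refine Ideal.span_le.2 (Set.iUnion₂_subset ?_)
  rintro ⟨i, p⟩ hip f hf
  refine diagU_subset_of_esymmSet_subset (esymmSet_subset_dpIdeal (isWeymanCell_iff.2 ?_))
    ((hB i p).2 ▸ Submodule.subset_span hf)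
  rcases eq_of_mem_weymanLabels hip with ⟨rfl, h1, h2⟩ | ⟨-, h2, rfl⟩
  · have := topEntry_add_le_card (μ := μ) (i := 1) (by omega)
    rw [topEntry_one] at this
    exact ⟨by omega, by rwa [topEntry_zero], by omega⟩
  · exact ⟨h2, le_rfl, topEntry_add_le_card h2⟩

end WeymanGenerators

/-! ### Deleting the columns m + 1, …, l. -/

section Line

variable {K : Type*} [Field K] [CharZero K] {μ : YoungDiagram} {s m l : ℕ}

theorem esymmSet_topEntry_subset_of_line (hm : m = 2 ∨ m = 3) (hml : m < l)
    (hl : l < μ.rowLen 0) (hb : ∀ i, 1 ≤ i → i ≤ l → topEntry μ i = i * s + m)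
    {J : Ideal (MvPolynomial (Fin μ.card) K)}
    (h0 : ∀ r, 1 ≤ r → r < topEntry μ 1 → esymmSet K μ.card r μ.card ⊆ J)
    (h : ∀ j, 1 ≤ j → j ≤ m → esymmSet K μ.card (topEntry μ j) (μ.card - j) ⊆ J) {i : ℕ}
    (hi : 1 ≤ i) (hil : i ≤ l) : esymmSet K μ.card (topEntry μ i) (μ.card - i) ⊆ J := by
  have hc := rowLen_zero_le_card μ
  rw [hb i hi hil]
  refine esymmSet_line_subset hm
    (fun r hr => esymmSet_univ_subset (by omega) h0 (h 1 le_rfl (by omega)) hr)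
    (fun j hj hjm => ?_) (by omega)
  rw [← hb j hj (by omega)]
  exact h j hj hjm

theorem esymmSet_subset_span_columnGens (hm : m = 2 ∨ m = 3) (hml : m < l)
    (hl : l < μ.rowLen 0) (hb : ∀ i, 1 ≤ i → i ≤ l → topEntry μ i = i * s + m)
    (hcol : ∀ j, 1 ≤ j → j ≤ m → 2 ≤ μ.colLen j) {i : ℕ} (hi : 1 ≤ i) (hil : i ≤ l) :
    esymmSet K μ.card (topEntry μ i) (μ.card - i) ⊆
      (Ideal.span (⋃ j ∈ {j | j ≤ m}, columnGens K μ j) :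
        Set (MvPolynomial (Fin μ.card) K)) := by
  refine esymmSet_topEntry_subset_of_line hm hml hl hb ?_ ?_ hi hil
  · exact fun r hr hr' f hf => Ideal.subset_span
      (Set.mem_biUnion (Nat.zero_le m) (Or.inl (Or.inl ⟨rfl, r, hr, hr', hf⟩)))
  · exact fun j hj hjm f hf => Ideal.subset_span
      (Set.mem_biUnion hjm (Or.inr ⟨Or.inl ⟨hj, hcol j hj hjm⟩, hf⟩))

theorem span_columnGens_diff (hm : m = 2 ∨ m = 3) (hml : m < l)
    (hl : l < μ.rowLen 0) (hb : ∀ i, 1 ≤ i → i ≤ l → topEntry μ i = i * s + m)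
    (hcol : ∀ j, 1 ≤ j → j ≤ m → 2 ≤ μ.colLen j) :
    Ideal.span (⋃ j ∈ {j | ¬ (m < j ∧ j ≤ l)}, columnGens K μ j) = dpIdeal K μ := by
  refine le_antisymm (Ideal.span_le.2 (Set.iUnion₂_subset fun j _ =>
    columnGens_subset_dpIdeal (by omega) j)) ?_
  rw [← span_columnGens (by omega)]
  refine Ideal.span_le.2 (Set.iUnion_subset fun j => ?_)
  by_cases hj : m < j ∧ j ≤ l
  · have hle : Ideal.span (⋃ j ∈ {j | j ≤ m}, columnGens K μ j) ≤
        Ideal.span (⋃ j ∈ {j | ¬ (m < j ∧ j ≤ l)}, columnGens K μ j) :=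
      Ideal.span_mono (Set.biUnion_subset_biUnion_left fun j (hj : j ≤ m) h => by omega)
    rintro f ((⟨h0, -⟩ | ⟨h0, -⟩) | ⟨-, hf⟩)
    · omega
    · omega
    · exact hle (esymmSet_subset_span_columnGens hm hml hl hb hcol (by omega) hj.2 hf)
  · exact fun f hf => Ideal.subset_span (Set.mem_biUnion hj hf)

variable {B : ℕ × ℕ → Set (MvPolynomial (Fin μ.card) K)}

theorem esymmSet_subset_span_genSet (hm : m = 2 ∨ m = 3) (hml : m < l) (hl : l < μ.rowLen 0)
    (hb : ∀ i, 1 ≤ i → i ≤ l → topEntry μ i = i * s + m) (h01 : μ.colLen 1 < μ.colLen 0)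
    (hB : ∀ i p, IsBasisSet K (B (i, p)) (diagU K μ.card i p)) {i : ℕ} (hi : 1 ≤ i)
    (hil : i ≤ l) : esymmSet K μ.card (topEntry μ i) (μ.card - i) ⊆
      (Ideal.span (genSet (weymanLabels μ ∩ {ip | ip.1 ≤ m}) B) :
        Set (MvPolynomial (Fin μ.card) K)) := by
  have h0 : ∀ p, 1 ≤ p → p ≤ μ.colLen 0 →
      (diagU K μ.card 0 p : Set (MvPolynomial (Fin μ.card) K)) ⊆
        (Ideal.span (genSet (weymanLabels μ ∩ {ip | ip.1 ≤ m}) B) :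
          Set (MvPolynomial (Fin μ.card) K)) := fun p hp hp' =>
    diagU_subset_span_genSet hB ⟨zero_mem_weymanLabels hp hp', Nat.zero_le m⟩
  refine esymmSet_topEntry_subset_of_line hm hml hl hb ?_ ?_ hi hil
  · intro r hr hr'
    rw [topEntry_one] at hr'
    exact (esymmSet_subset_diagU_zero _ _).trans (h0 r hr hr'.le)
  · intro j hj hjm
    refine esymmSet_topEntry_subset (N := m + 1) (by omega) h0 (fun k hk hkm => Or.inl ?_) hj
      (by omega)
    exact diagU_subset_span_genSet hB
      ⟨mem_weymanLabels_of_lt h01 hk (by omega), Nat.lt_succ_iff.1 hkm⟩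

theorem span_genSet_weymanLabels_diff (hm : m = 2 ∨ m = 3) (hml : m < l) (hl : l < μ.rowLen 0)
    (hb : ∀ i, 1 ≤ i → i ≤ l → topEntry μ i = i * s + m) (h01 : μ.colLen 1 < μ.colLen 0)
    (hB : ∀ i p, IsBasisSet K (B (i, p)) (diagU K μ.card i p)) :
    Ideal.span (genSet (weymanLabels μ \ {ip | m < ip.1 ∧ ip.1 ≤ l}) B) = dpIdeal K μ := by
  refine le_antisymm ((Ideal.span_mono (Set.biUnion_subset_biUnion_left Set.sdiff_subset)).trans
    (span_genSet_weymanLabels_le (by omega) hB)) ?_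
  have h0 : ∀ p, 1 ≤ p → p ≤ μ.colLen 0 →
      (diagU K μ.card 0 p : Set (MvPolynomial (Fin μ.card) K)) ⊆
        (Ideal.span (genSet (weymanLabels μ \ {ip | m < ip.1 ∧ ip.1 ≤ l}) B) :
          Set (MvPolynomial (Fin μ.card) K)) := fun p hp hp' =>
    diagU_subset_span_genSet hB ⟨zero_mem_weymanLabels hp hp', fun h => absurd h.1 (by simp)⟩
  have hle : Ideal.span (genSet (weymanLabels μ ∩ {ip | ip.1 ≤ m}) B) ≤
      Ideal.span (genSet (weymanLabels μ \ {ip | m < ip.1 ∧ ip.1 ≤ l}) B) :=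
    Ideal.span_mono (Set.biUnion_subset_biUnion_left fun ip hip =>
      ⟨hip.1, fun h => absurd h.1 (not_lt.2 hip.2)⟩)
  refine dpIdeal_le (by omega) ?_ fun i hi hi' => ?_
  · intro r hr hr'
    rw [topEntry_one] at hr'
    exact (esymmSet_subset_diagU_zero _ _).trans (h0 r hr hr'.le)
  · refine esymmSet_topEntry_subset le_rfl h0 (fun k hk hk' => ?_) hi hi'
    by_cases hkl : k ≤ l
    · exact Or.inr ((esymmSet_subset_span_genSet hm hml hl hb h01 hB hk hkl).trans hle)
    · exact Or.inl (diagU_subset_span_genSet hB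
        ⟨mem_weymanLabels_of_lt h01 hk hk', fun h => hkl h.2⟩)

theorem not_isMinimalGeneratingSet_genSet (hm : m = 2 ∨ m = 3) (hs : 1 ≤ s) (hml : m < l)
    (hl : l < μ.rowLen 0) (hb : ∀ i, 1 ≤ i → i ≤ l → topEntry μ i = i * s + m)
    (h01 : μ.colLen 1 < μ.colLen 0)
    (hB : ∀ i p, IsBasisSet K (B (i, p)) (diagU K μ.card i p))
    (hne : diagU K μ.card l (topEntry μ l) ≠ ⊥) :
    ¬ IsMinimalGeneratingSet (dpIdeal K μ) (genSet (weymanLabels μ) B) := by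
  rintro ⟨hspan, hmin⟩
  obtain ⟨f, hf⟩ : (B (l, topEntry μ l)).Nonempty := by
    by_contra h
    rw [Set.not_nonempty_iff_eq_empty] at h
    exact hne (by rw [← (hB l _).2, h, Submodule.span_empty])
  have hf0 : f ≠ 0 := (hB l _).1.ne_zero hf
  have hfU : f ∈ diagU K μ.card l (topEntry μ l) := (hB l _).2 ▸ Submodule.subset_span hf
  have hfW : f ∈ genSet (weymanLabels μ) B :=
    Set.mem_biUnion (mem_weymanLabels_of_lt h01 (by omega) hl) hf
  have hlt : topEntry μ m < topEntry μ l := by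
    rw [hb m (by omega) hml.le, hb l (by omega) le_rfl]
    have := Nat.mul_lt_mul_of_pos_right hml hs
    omega
  -- The bases are arbitrary sets, so overlaps must be excluded: generators from columns up to m
  -- have degree at most b_m < b_l, the degree of f.
  have hfn : f ∉ genSet (weymanLabels μ ∩ {ip | ip.1 ≤ m}) B := by
    intro h
    obtain ⟨⟨j, p⟩, ⟨hlab, hjm⟩, hfj⟩ := Set.mem_iUnion₂.1 h
    have hp := (isHomogeneous_of_mem_diagU hfU).inj_right
      (isHomogeneous_of_mem_diagU ((hB j p).2 ▸ Submodule.subset_span hfj)) hf0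
    rcases eq_of_mem_weymanLabels hlab with ⟨-, -, h2⟩ | ⟨h1, -, h2⟩
    · rw [← topEntry_one] at h2
      have := topEntry_mono (μ := μ) (show 1 ≤ m by omega) (by omega)
      omega
    · have := topEntry_mono (μ := μ) (show j ≤ m from hjm) (by omega)
      omega
  have hsub : genSet (weymanLabels μ ∩ {ip | ip.1 ≤ m}) B ⊆ genSet (weymanLabels μ) B \ {f} :=
    fun h hh => ⟨Set.biUnion_subset_biUnion_left Set.inter_subset_left hh, by
      rintro rfl
      exact hfn hh⟩
  have hfmem : f ∈ Ideal.span (genSet (weymanLabels μ) B \ {f}) :=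
    Ideal.span_mono hsub (diagU_subset_of_esymmSet_subset
      (esymmSet_subset_span_genSet hm hml hl hb h01 hB (by omega) le_rfl) hfU)
  refine hmin _ (Set.sdiff_singleton_ssubset.2 hfW) (le_antisymm ?_ ?_)
  · rw [← hspan]
    exact Ideal.span_mono Set.sdiff_subset
  · rw [← hspan]
    refine Ideal.span_le.2 fun h hh => ?_
    by_cases hhf : h = f
    · exact hhf ▸ hfmem
    · exact Ideal.subset_span ⟨hh, hhf⟩

end Line

end DeConciniProcesi

end

open DeConciniProcesi in
theorem mainTheorem8 (K : Type*) [Field K] [CharZero K] (μ : YoungDiagram) (g m l : ℕ)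
    (hfam : (m = 2 ∧ IsFamilyOne g (firstColumns μ (l + 1))) ∨
      (m = 3 ∧ IsFamilyTwo g (firstColumns μ (l + 1))))
    (hml : m < l) (hl : l < μ.rowLen 0) :
    -- the top cells of columns `1, …, l` lie on a line through `(0, m)`, and the conjecture
    -- predicts that each of them contributes generators
    (∀ i, 1 ≤ i → i ≤ l →
      topEntry μ i = i * (g + 1 - m) + m ∧
      (i, topEntry μ i) ∈ weymanLabels μ ∧
      diagU K μ.card i (topEntry μ i) ≠ ⊥) ∧
    -- columns `m + 1, …, l` are redundant in the reduced generating set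
    Ideal.span (⋃ j, columnGens K μ j) = dpIdeal K μ ∧
    Ideal.span (⋃ j ∈ {j | ¬ (m < j ∧ j ≤ l)}, columnGens K μ j) = dpIdeal K μ ∧
    (∀ i, m < i → i ≤ l →
      esymmSet K μ.card (topEntry μ i) (μ.card - i) ⊆
        (Ideal.span (⋃ j ∈ {j | j ≤ m}, columnGens K μ j) :
          Set (MvPolynomial (Fin μ.card) K))) ∧
    -- they are redundant in the generating set predicted by the conjecture, which is therefore
    -- not minimal
    (∀ B : ℕ × ℕ → Set (MvPolynomial (Fin μ.card) K),
      (∀ i p, IsBasisSet K (B (i, p)) (diagU K μ.card i p)) →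
      Ideal.span (genSet (weymanLabels μ) B) = dpIdeal K μ ∧
      Ideal.span (genSet (weymanLabels μ \ {ip | m < ip.1 ∧ ip.1 ≤ l}) B) = dpIdeal K μ ∧
      (∀ i, m < i → i ≤ l → B (i, topEntry μ i) ⊆
        (Ideal.span (genSet (weymanLabels μ ∩ {ip | ip.1 ≤ m}) B) :
          Set (MvPolynomial (Fin μ.card) K))) ∧
      ¬ IsMinimalGeneratingSet (dpIdeal K μ) (genSet (weymanLabels μ) B)) := by
  have hm : m = 2 ∨ m = 3 := hfam.imp And.left And.left
  obtain ⟨hmg, h0, h1⟩ := colLen_of_family hfam hl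
  have hb : ∀ i, 1 ≤ i → i ≤ l → topEntry μ i = i * (g + 1 - m) + m := fun i hi hil =>
    topEntry_eq_of_colLen hl (by omega) (fun j hj hjl => by rw [h1 j hj hjl]; omega) hi hil
  have h01 : μ.colLen 1 < μ.colLen 0 := by
    rw [h0, h1 1 le_rfl (by omega)]
    omega
  have hcol : ∀ j, 1 ≤ j → j ≤ m → 2 ≤ μ.colLen j := fun j hj hjm => by
    rw [h1 j hj (by omega)]
    omega
  have hne : ∀ i, 1 ≤ i → i ≤ l → diagU K μ.card i (topEntry μ i) ≠ ⊥ := fun i hi hil => by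
    refine diagU_ne_bot hi ?_ (topEntry_add_le_card (by omega))
    -- The bound i ≤ b_i needed for nonvanishing holds because the slope g + 1 - m is positive.
    rw [hb i hi hil]
    have := Nat.le_mul_of_pos_right i (show 0 < g + 1 - m by omega)
    omega
  refine ⟨fun i hi hil => ⟨hb i hi hil, mem_weymanLabels_of_lt h01 hi (by omega), hne i hi hil⟩,
    span_columnGens (by omega), span_columnGens_diff hm hml hl hb hcol,
    fun i hi hil => esymmSet_subset_span_columnGens hm hml hl hb hcol (by omega) hil,
    fun B hB => ?_⟩
  have hdiff := span_genSet_weymanLabels_diff hm hml hl hb h01 hB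
  refine ⟨le_antisymm (span_genSet_weymanLabels_le (by omega) hB) ?_, hdiff, fun i hi hil f hf => ?_,
    not_isMinimalGeneratingSet_genSet hm (by omega) hml hl hb h01 hB (hne l (by omega) le_rfl)⟩
  · rw [← hdiff]
    exact Ideal.span_mono (Set.biUnion_subset_biUnion_left Set.sdiff_subset)
  · exact diagU_subset_of_esymmSet_subset
      (esymmSet_subset_span_genSet hm hml hl hb h01 hB (by omega) hil)
      ((hB i _).2 ▸ Submodule.subset_span hf)
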